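/- Let $A$ be a unital $C^*$-algebra, $\Gamma$ a totally ordered abelian group with positive cone $\Gamma^+=\{x\in\Gamma: x\ge 0\}$, and $\alpha$ an action of $\Gamma^+$ on $A$ by (not necessarily unital) $*$-endomorphisms: $\alpha_0=\mathrm{id}$, $\alpha_{x+y}=\alpha_x\circ\alpha_y$. Let $L$ be a complete transfer action for $(A,\Gamma^+,\alpha)$, i.e. continuous linear positive maps $L_x:A\to A$ $(x\in\Gamma^+)$ with $L_{x+y}=L_y\circ L_x$, $L_x(\alpha_x(a)b)=aL_x(b)$ and $\alpha_x(L_x(a))=\alpha_x(1)a\alpha_x(1)$. *Crossed product.* Let $l_1(\Gamma,\alpha,A)$ be the unital Banach $*$-algebra of all families $a=(a_g)_{g\in\Gamma}$ in $A$ with $a_x\in A\alpha_x(1)$ and $a_{-x}\in\alpha_x(1)A$ for $x\in\Gamma^+$ and $\|a\|=\sum_g\|a_g\|<\infty$, with $(a^*)_g=(a_{-g})^*$ and $$(ab)_g=\sum_{\substack{x-y=g\\x,y>0}}a_x\alpha_{x-y}(b_{-y})+\sum_{\substack{y-x=g\\x,y>0}}L_x(a_{-x}b_y)+\sum_{\substack{x+y=g\\x,y\ge0}}a_x\alpha_x(b_y)\quad(g\ge0),$$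 $$(ab)_g=\sum_{\substack{x-y=g\\x,y>0}}\alpha_{y-x}(a_x)b_{-y}+\sum_{\substack{y-x=g\\x,y>0}}L_y(a_{-x}b_y)+\sum_{\substack{-x-y=g\\x,y\ge0}}\alpha_y(a_{-x})b_{-y}\quad(g<0).$$ The crossed product $A\rtimes_\alpha\Gamma$ is the enveloping $C^*$-algebra of $l_1(\Gamma,\alpha,A)$. *Covariant representations and property (\*).* A covariant representation is a triple $(\pi,U,H)$ of a Hilbert space $H$, a non-degenerate representation $\pi:A\to B(H)$ and a homomorphism $U:\Gamma^+\to B(H)$, $U_0=1$, $U_{x+y}=U_xU_y$, such that $U_x\pi(a)U_x^*=\pi(\alpha_x(a))$ and $U_x^*\pi(a)U_x=\pi(L_x(a))$. It has property (\*) if for every finite $F\subset\Gamma^+\setminus\{0\}$ and all $a_0\in A$, $a_x\in A\alpha_x(1)$, $a_{-x}\in\alpha_x(1)A$ $(x\in F)$, $$\|a_0\|\le\Big\|\sum_{x\in F}U_x^*\pi(a_{-x})+\pi(a_0)+\sum_{x\in F}\pi(a_x)U_x\Big\|.$$ *The regular space.* For a positive linear functional $f$ on $A$ and $g\in\Gamma$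 let $H_g^f$ be the Hilbert space obtained by separation and completion from $A$ with the semi-inner product $\langle v,u\rangle_g=f(L_g(u^*v))$ if $g\ge0$ and $\langle v,u\rangle_g=f(u^*\alpha_{-g}(1)v)$ if $g\le0$. Let $H=\bigoplus_f\bigoplus_{g\in\Gamma}H_g^f$ (Hilbert direct sum over all positive functionals $f$ and all $g$). *Theorem (regular representation).* There are exactly one non-degenerate representation $\pi:A\to B(H)$ and one family $U_x\in B(H)$ $(x\in\Gamma^+)$ such that $\pi(a)$ maps the class of $v\in A$ in $H_g^f$ to the class in $H_g^f$ of $av$ if $g\ge0$, and of $\alpha_{-g}(a)v$ if $g\le0$; and $U_x$ maps the class of $v\in A$ in $H_{g-x}^f$ to the class in $H_g^f$ of $$\alpha_x(v)\ \text{ if } x\le g,\qquad \alpha_x(1)\alpha_g(v)\ \text{ if } 0\le g\le x,\qquad \alpha_{x-g}(1)v\ \text{ if } g\le0.$$ The triple $(\pi,U,H)$ is a covariant representation of $(A,\Gamma^+,\alpha)$ and has property (\*). There is exactly one representation $\pi\times U$ of $A\rtimes_\alpha\Gamma$ on $H$ that sends the image of $a\in l_1(\Gamma,\alpha,A)$ to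 $\sum_{x>0}U_x^*\pi(a_{-x})+\pi(a_0)+\sum_{x>0}\pi(a_x)U_x$ for every $a$, and $\pi\times U$ is faithful. -/

import Mathlib

noncomputable section

open scoped ComplexOrder

set_option linter.unusedSectionVars false

namespace Enveloping

universe w

section

variable (R : Type w) [NormedRing R] [StarRing R] [NormedAlgebra ℂ R]

/-- The numbers `‖ρ a‖`, where `ρ` runs through the non-degenerate `*`-representations of the
unital `*`-algebra `R` on Hilbert spaces. (A representation of a unital algebra is non-degenerate
iff it is unital.) -/
def repNorms (a : R) : Set ℝ :=
  {r | ∃ (H : Type w) (_ : NormedAddCommGroup H) (_ : InnerProductSpace ℂ H) (_ : CompleteSpace H)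
    (ρ : R →⋆ₐ[ℂ] (H →L[ℂ] H)), r = ‖ρ a‖}

/-- The largest `C^*`-seminorm of `R`: the supremum of `‖ρ a‖` over all representations `ρ`. -/
def envNorm (a : R) : ℝ := sSup (repNorms R a)

lemma repNorms_zero_mem (a : R) : (0 : ℝ) ∈ repNorms R a := by
  let ρ : R →⋆ₐ[ℂ] (PUnit.{w + 1} →L[ℂ] PUnit.{w + 1}) :=
    { toFun := fun _ => 0
      map_one' := Subsingleton.elim _ _
      map_mul' := fun _ _ => Subsingleton.elim _ _
      map_zero' := rfl
      map_add' := fun _ _ => Subsingleton.elim _ _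
      commutes' := fun _ => Subsingleton.elim _ _
      map_star' := fun _ => Subsingleton.elim _ _ }
  refine ⟨PUnit.{w + 1}, inferInstance, inferInstance, inferInstance, ρ, ?_⟩
  have : ρ a = 0 := Subsingleton.elim _ _
  rw [this, norm_zero]

end

section

variable (R : Type w) [NormedRing R] [StarRing R] [NormedStarGroup R] [NormedAlgebra ℂ R]
  [CompleteSpace R]

lemma norm_rep_sq_le {B : Type*} [CStarAlgebra B] (ρ : R →⋆ₐ[ℂ] B) (a : R) :
    ‖ρ a‖ ^ 2 ≤ ‖a‖ ^ 2 * ‖(1 : R)‖ := by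
  set s : R := star a * a with hs
  have h1 : ‖ρ s‖ = ‖ρ a‖ ^ 2 := by
    rw [hs, map_mul, map_star, CStarRing.norm_star_mul_self, sq]
  have hsa : IsSelfAdjoint (ρ s) := (IsSelfAdjoint.star_mul_self a).map ρ
  have h2 : (‖ρ s‖₊ : ENNReal) ≤ ((‖s‖₊ * ‖(1 : R)‖₊ : NNReal) : ENNReal) := by
    rw [← hsa.spectralRadius_eq_nnnorm]
    refine (iSup_le_iSup_of_subset (AlgHom.spectrum_apply_subset ρ s)).trans ?_
    refine iSup₂_le fun k hk => ?_
    exact_mod_cast spectrum.norm_le_norm_mul_of_mem hk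
  have h3 : ‖ρ s‖ ≤ ‖s‖ * ‖(1 : R)‖ := by exact_mod_cast h2
  have h4 : ‖s‖ ≤ ‖a‖ ^ 2 := by
    calc ‖s‖ ≤ ‖star a‖ * ‖a‖ := norm_mul_le _ _
      _ = ‖a‖ ^ 2 := by rw [norm_star, sq]
  rw [← h1]
  exact h3.trans (mul_le_mul_of_nonneg_right h4 (norm_nonneg _))

lemma bddAbove_repNorms (a : R) : BddAbove (repNorms R a) := by
  refine ⟨Real.sqrt (‖a‖ ^ 2 * ‖(1 : R)‖), ?_⟩
  rintro r ⟨H, _, _, _, ρ, rfl⟩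
  exact Real.le_sqrt_of_sq_le (norm_rep_sq_le R ρ a)

variable {R}

lemma norm_rep_le_envNorm {H : Type w} [NormedAddCommGroup H] [InnerProductSpace ℂ H]
    [CompleteSpace H] (ρ : R →⋆ₐ[ℂ] (H →L[ℂ] H)) (a : R) : ‖ρ a‖ ≤ envNorm R a :=
  le_csSup (bddAbove_repNorms R a) ⟨H, _, _, _, ρ, rfl⟩

lemma envNorm_nonneg (a : R) : 0 ≤ envNorm R a :=
  le_csSup (bddAbove_repNorms R a) (repNorms_zero_mem R a)

lemma envNorm_le {a : R} {c : ℝ}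
    (h : ∀ (H : Type w) [NormedAddCommGroup H] [InnerProductSpace ℂ H] [CompleteSpace H]
      (ρ : R →⋆ₐ[ℂ] (H →L[ℂ] H)), ‖ρ a‖ ≤ c) : envNorm R a ≤ c := by
  refine csSup_le ⟨0, repNorms_zero_mem R a⟩ ?_
  rintro r ⟨H, _, _, _, ρ, rfl⟩
  exact h H ρ

lemma envNorm_zero : envNorm R 0 = 0 :=
  le_antisymm (envNorm_le fun H _ _ _ ρ => by simp) (envNorm_nonneg 0)

lemma envNorm_add_le (a b : R) : envNorm R (a + b) ≤ envNorm R a + envNorm R b :=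
  envNorm_le fun H _ _ _ ρ => by
    rw [map_add]
    exact (norm_add_le _ _).trans (add_le_add (norm_rep_le_envNorm ρ a) (norm_rep_le_envNorm ρ b))

lemma envNorm_neg (a : R) : envNorm R (-a) = envNorm R a := by
  have h (b : R) : envNorm R (-b) ≤ envNorm R b := envNorm_le fun H _ _ _ ρ => by
    rw [map_neg, norm_neg]
    exact norm_rep_le_envNorm ρ b
  exact le_antisymm (h a) (by simpa using h (-a))

lemma envNorm_mul_le (a b : R) : envNorm R (a * b) ≤ envNorm R a * envNorm R b :=
  envNorm_le fun H _ _ _ ρ => by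
    rw [map_mul]
    exact (norm_mul_le _ _).trans (mul_le_mul (norm_rep_le_envNorm ρ a) (norm_rep_le_envNorm ρ b)
      (norm_nonneg _) (envNorm_nonneg a))

lemma envNorm_smul_le (c : ℂ) (a : R) : envNorm R (c • a) ≤ ‖c‖ * envNorm R a :=
  envNorm_le fun H _ _ _ ρ => by
    rw [map_smul, norm_smul]
    exact mul_le_mul_of_nonneg_left (norm_rep_le_envNorm ρ a) (norm_nonneg _)

lemma envNorm_star (a : R) : envNorm R (star a) = envNorm R a := by
  have h (b : R) : envNorm R (star b) ≤ envNorm R b := envNorm_le fun H _ _ _ ρ => by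
    rw [map_star, norm_star]
    exact norm_rep_le_envNorm ρ b
  exact le_antisymm (h a) (by simpa using h (star a))

lemma envNorm_mul_self_le (a : R) : envNorm R a * envNorm R a ≤ envNorm R (star a * a) := by
  have h : envNorm R a ≤ Real.sqrt (envNorm R (star a * a)) := envNorm_le fun H _ _ _ ρ => by
    refine Real.le_sqrt_of_sq_le ?_
    rw [sq, ← CStarRing.norm_star_mul_self, ← map_star, ← map_mul]
    exact norm_rep_le_envNorm ρ _
  calc envNorm R a * envNorm R a
      ≤ Real.sqrt (envNorm R (star a * a)) * Real.sqrt (envNorm R (star a * a)) :=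
        mul_self_le_mul_self (envNorm_nonneg a) h
    _ = _ := Real.mul_self_sqrt (envNorm_nonneg _)

end

/-- `R` with the seminorm `envNorm` in place of its norm. -/
def Pre (R : Type w) : Type w := R

section

variable (R : Type w) [NormedRing R] [StarRing R] [NormedStarGroup R] [NormedAlgebra ℂ R]
  [StarModule ℂ R] [CompleteSpace R]

instance : Ring (Pre R) := inferInstanceAs (Ring R)
instance : Algebra ℂ (Pre R) := inferInstanceAs (Algebra ℂ R)
instance : StarRing (Pre R) := inferInstanceAs (StarRing R)
instance : StarModule ℂ (Pre R) := inferInstanceAs (StarModule ℂ R)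

instance : SeminormedRing (Pre R) where
  __ := (inferInstance : Ring (Pre R))
  __ := AddGroupSeminorm.toSeminormedAddCommGroup
    ({ toFun := fun a => envNorm R a
       map_zero' := envNorm_zero (R := R)
       add_le' := envNorm_add_le (R := R)
       neg' := envNorm_neg (R := R) } : AddGroupSeminorm (Pre R))
  norm_mul_le := envNorm_mul_le (R := R)

lemma Pre.norm_def (a : Pre R) : ‖a‖ = envNorm R a := rfl

instance : NormedAlgebra ℂ (Pre R) where
  norm_smul_le := envNorm_smul_le (R := R)

instance : NormedStarGroup (Pre R) where
  norm_star_le a := (envNorm_star (R := R) a).le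

/-- The enveloping `C^*`-algebra of the unital Banach `*`-algebra `R`: the Hausdorff completion of
`R` in its largest `C^*`-seminorm. -/
def EnvelopingAlgebra : Type w := UniformSpace.Completion (Pre R)

namespace EnvelopingAlgebra

open UniformSpace

instance : NormedRing (EnvelopingAlgebra R) := inferInstanceAs (NormedRing (Completion (Pre R)))

instance : CompleteSpace (EnvelopingAlgebra R) :=
  inferInstanceAs (CompleteSpace (Completion (Pre R)))

instance : Algebra ℂ (EnvelopingAlgebra R) := inferInstanceAs (Algebra ℂ (Completion (Pre R)))

instance : NormedAlgebra ℂ (EnvelopingAlgebra R) where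
  norm_smul_le := norm_smul_le (α := ℂ) (β := Completion (Pre R))

/-- The canonical ring homomorphism of `R` into its enveloping algebra. -/
def coeHom : R →+* EnvelopingAlgebra R := (Completion.coeRingHom : Pre R →+* Completion (Pre R))

lemma coeHom_denseRange : DenseRange (coeHom R) := Completion.denseRange_coe (α := Pre R)

lemma norm_coeHom (a : R) : ‖coeHom R a‖ = envNorm R a := Completion.norm_coe (E := Pre R) a

lemma coeHom_smul (c : ℂ) (a : R) : coeHom R (c • a) = c • coeHom R a :=
  Completion.coe_smul (M := ℂ) (X := Pre R) c a

instance : Star (EnvelopingAlgebra R) :=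
  ⟨Completion.map (star : Pre R → Pre R)⟩

lemma star_coeHom (a : R) : star (coeHom R a) = coeHom R (star a) :=
  Completion.map_coe (starₗᵢ ℂ : Pre R ≃ₗᵢ⋆[ℂ] Pre R).isometry.uniformContinuous _

lemma continuous_star' : Continuous (star : EnvelopingAlgebra R → EnvelopingAlgebra R) :=
  Completion.continuous_map

lemma continuous_coeHom_ind {p : EnvelopingAlgebra R → Prop} (hp : IsClosed {x | p x})
    (h : ∀ a, p (coeHom R a)) (x : EnvelopingAlgebra R) : p x :=
  isClosed_property (coeHom_denseRange R) hp h x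

lemma coeHom_ind₂ {p : EnvelopingAlgebra R → EnvelopingAlgebra R → Prop}
    (hp : IsClosed {x : EnvelopingAlgebra R × EnvelopingAlgebra R | p x.1 x.2})
    (h : ∀ a b, p (coeHom R a) (coeHom R b)) (x y : EnvelopingAlgebra R) : p x y :=
  isClosed_property2 (coeHom_denseRange R) hp h x y

instance : StarRing (EnvelopingAlgebra R) where
  star_involutive x := by
    induction x using continuous_coeHom_ind with
    | hp => exact isClosed_eq ((continuous_star' R).comp (continuous_star' R)) continuous_id
    | h a => rw [star_coeHom, star_coeHom, star_star]
  star_mul x y := by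
    induction x, y using coeHom_ind₂ with
    | hp =>
      exact isClosed_eq ((continuous_star' R).comp (continuous_fst.mul continuous_snd))
        (((continuous_star' R).comp continuous_snd).mul ((continuous_star' R).comp continuous_fst))
    | h a b => rw [← map_mul, star_coeHom, star_coeHom, star_coeHom, star_mul, map_mul]
  star_add x y := by
    induction x, y using coeHom_ind₂ with
    | hp =>
      exact isClosed_eq ((continuous_star' R).comp (continuous_fst.add continuous_snd))
        (((continuous_star' R).comp continuous_fst).add ((continuous_star' R).comp continuous_snd))
    | h a b => rw [← map_add, star_coeHom, star_coeHom, star_coeHom, star_add, map_add]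

instance : CStarRing (EnvelopingAlgebra R) where
  norm_mul_self_le x := by
    induction x using continuous_coeHom_ind with
    | hp =>
      exact isClosed_le (continuous_norm.mul continuous_norm)
        (continuous_norm.comp ((continuous_star' R).mul continuous_id))
    | h a =>
      rw [star_coeHom, ← map_mul, norm_coeHom, norm_coeHom]
      exact envNorm_mul_self_le a

instance : StarModule ℂ (EnvelopingAlgebra R) where
  star_smul c x := by
    induction x using continuous_coeHom_ind with
    | hp =>
      exact isClosed_eq ((continuous_star' R).comp (continuous_const_smul c))
        ((continuous_const_smul (star c)).comp (continuous_star' R))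
    | h a => rw [← coeHom_smul, star_coeHom, star_coeHom, star_smul, coeHom_smul]

instance : CStarAlgebra (EnvelopingAlgebra R) where

/-- The canonical `*`-homomorphism of `R` into its enveloping `C^*`-algebra. -/
def ι : R →⋆ₐ[ℂ] EnvelopingAlgebra R where
  __ := coeHom R
  commutes' c := by
    change coeHom R (algebraMap ℂ R c) = _
    rw [Algebra.algebraMap_eq_smul_one, coeHom_smul, map_one, Algebra.algebraMap_eq_smul_one]
  map_star' a := (star_coeHom R a).symm

end EnvelopingAlgebra

end

end Enveloping

namespace CrossedProduct

universe u v

/-- The positive cone `Γ⁺` of a totally ordered abelian group `Γ`. -/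
abbrev Cone (Γ : Type v) [AddCommGroup Γ] [LinearOrder Γ] : Type v := {x : Γ // 0 ≤ x}

variable {A : Type u} [CStarAlgebra A] {Γ : Type v} [AddCommGroup Γ] [LinearOrder Γ]

/-- `max g 0` as an element of the cone; for `0 ≤ g` this is `g` itself. -/
def cone (g : Γ) : Cone Γ := ⟨max g 0, le_max_right _ _⟩

variable [IsOrderedAddMonoid Γ]

variable (A Γ) in
/-- A `C^*`-dynamical system `(A, Γ⁺, α)`: an action of `Γ⁺` on `A` by (not necessarily unital)
`*`-endomorphisms. -/
structure DynamicalSystem where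
  α : Cone Γ → (A →⋆ₙₐ[ℂ] A)
  α_zero : ∀ a, α 0 a = a
  α_add : ∀ x y a, α (x + y) a = α x (α y a)

variable [PartialOrder A] [StarOrderedRing A]

/-- A complete transfer action for `(A, Γ⁺, α)`. -/
structure CompleteTransferAction (S : DynamicalSystem A Γ) where
  L : Cone Γ → (A →L[ℂ] A)
  nonneg : ∀ x a, 0 ≤ a → 0 ≤ L x a
  L_add : ∀ x y a, L (x + y) a = L y (L x a)
  transfer : ∀ x a b, L x (S.α x a * b) = a * L x b
  complete : ∀ x a, S.α x (L x a) = S.α x 1 * a * S.α x 1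

namespace CompleteTransferAction

variable {S : DynamicalSystem A Γ} (T : CompleteTransferAction S)

lemma L_star (x : Cone Γ) (a : A) : T.L x (star a) = star (T.L x a) := by
  let f : A →ₚ[ℂ] A := PositiveLinearMap.mk₀ (T.L x : A →ₗ[ℂ] A) (T.nonneg x)
  exact map_star f a

lemma transfer' (x : Cone Γ) (a b : A) : T.L x (b * S.α x a) = T.L x b * a := by
  have h := T.transfer x (star a) (star b)
  rw [map_star, ← star_mul, L_star, L_star, ← star_mul] at h
  exact star_injective h

lemma L_one_mul (x : Cone Γ) (a : A) : T.L x (S.α x 1 * a) = T.L x a := by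
  rw [T.transfer, one_mul]

lemma L_mul_one (x : Cone Γ) (a : A) : T.L x (a * S.α x 1) = T.L x a := by
  rw [T.transfer', mul_one]

lemma L_α (x : Cone Γ) (a : A) : T.L x (S.α x a) = a * T.L x 1 := by
  rw [← T.transfer, mul_one]

lemma L_α' (x : Cone Γ) (a : A) : T.L x (S.α x a) = T.L x 1 * a := by
  rw [← T.transfer', one_mul]

lemma comm_L_one (x : Cone Γ) (a : A) : T.L x 1 * a = a * T.L x 1 := by
  rw [← L_α, L_α']

lemma α_L_one (x : Cone Γ) : S.α x (T.L x 1) = S.α x 1 := by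
  rw [T.complete, mul_one, ← map_mul, one_mul]

lemma L_mul_L_one (x : Cone Γ) (a : A) : T.L x a * T.L x 1 = T.L x a := by
  rw [← T.transfer', T.α_L_one, L_mul_one]

lemma L_one_mul_L (x : Cone Γ) (a : A) : T.L x 1 * T.L x a = T.L x a := by
  rw [comm_L_one, L_mul_L_one]

lemma star_L_one (x : Cone Γ) : star (T.L x 1) = T.L x 1 := by
  rw [← L_star, star_one]

lemma L_zero (a : A) : T.L 0 a = a := by
  have h := T.complete 0 a
  simpa only [S.α_zero, one_mul, mul_one] using h

/-- The injective `*`-homomorphism `a ↦ (α_x(a), (1 - L_x(1)) a)` of `A` into `A × A`. -/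
def split (x : Cone Γ) : A →⋆ₙₐ[ℂ] A × A where
  toFun a := (S.α x a, a - T.L x 1 * a)
  map_smul' c a := by simp [smul_sub]
  map_zero' := by simp
  map_add' a b := by
    ext
    · simp
    · simp only [mul_add, Prod.snd_add]; abel
  map_mul' a b := by
    have h : T.L x 1 * (a * (T.L x 1 * b)) = T.L x 1 * (a * b) := by
      rw [← mul_assoc a, ← T.comm_L_one x a, ← mul_assoc, ← mul_assoc, T.L_mul_L_one, mul_assoc]
    ext
    · simp
    · simp only [Prod.snd_mul, mul_sub, sub_mul, mul_assoc, h]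
      rw [← mul_assoc a, ← T.comm_L_one x a, mul_assoc]
      abel
  map_star' a := by
    ext
    · simp [map_star]
    · simp only [Prod.snd_star, star_sub, star_mul, T.star_L_one, T.comm_L_one]

lemma split_injective (x : Cone Γ) : Function.Injective (T.split x) := by
  refine (injective_iff_map_eq_zero _).2 fun a ha => ?_
  have h1 : S.α x a = 0 := congrArg Prod.fst ha
  have h2 : a - T.L x 1 * a = 0 := congrArg Prod.snd ha
  rw [sub_eq_zero.1 h2, ← T.L_α', h1, map_zero]

lemma norm_L_le (x : Cone Γ) (a : A) : ‖T.L x a‖ ≤ ‖a‖ := by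
  have h1 : ‖T.split x (T.L x a)‖ = ‖T.L x a‖ :=
    NonUnitalStarAlgHom.norm_map (T.split x) (T.split_injective x) _
  have h2 : T.split x (T.L x a) = (S.α x 1 * a * S.α x 1, 0) :=
    Prod.ext (T.complete x a) (by change _ - _ = _; rw [T.L_one_mul_L, sub_self])
  have h3 : ‖S.α x 1‖ ≤ 1 := by
    have h : ‖S.α x 1‖ * ‖S.α x 1‖ = ‖S.α x 1‖ := by
      rw [← CStarRing.norm_star_mul_self, ← map_star, ← map_mul, star_one, one_mul]
    nlinarith [norm_nonneg (S.α x 1)]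
  rw [← h1, h2, Prod.norm_mk, norm_zero, max_eq_left (norm_nonneg _)]
  calc ‖S.α x 1 * a * S.α x 1‖ ≤ ‖S.α x 1‖ * ‖a‖ * ‖S.α x 1‖ := norm_mul₃_le
    _ ≤ 1 * ‖a‖ * 1 := by gcongr
    _ = ‖a‖ := by ring

end CompleteTransferAction

lemma cone_of_nonneg {g : Γ} (h : 0 ≤ g) : cone g = ⟨g, h⟩ := Subtype.ext (max_eq_left h)

lemma cone_of_nonpos {g : Γ} (h : g ≤ 0) : cone g = 0 := Subtype.ext (max_eq_right h)

lemma cone_coe (x : Cone Γ) : cone (x : Γ) = x := cone_of_nonneg x.2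

lemma cone_add {g h : Γ} (hg : 0 ≤ g) (hh : 0 ≤ h) : cone (g + h) = cone g + cone h := by
  rw [cone_of_nonneg hg, cone_of_nonneg hh, cone_of_nonneg (add_nonneg hg hh)]; rfl

lemma DynamicalSystem.α_norm_le (S : DynamicalSystem A Γ) (x : Cone Γ) (a : A) :
    ‖S.α x a‖ ≤ ‖a‖ := NonUnitalStarAlgHom.norm_apply_le _ _

lemma DynamicalSystem.α_cone_add (S : DynamicalSystem A Γ) {g h k : Γ} (hg : 0 ≤ g) (hh : 0 ≤ h)
    (hk : k = g + h) (a : A) : S.α (cone k) a = S.α (cone g) (S.α (cone h) a) := by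
  rw [hk, cone_add hg hh, S.α_add]

lemma CompleteTransferAction.L_cone_add {S : DynamicalSystem A Γ} (T : CompleteTransferAction S)
    {g h k : Γ} (hg : 0 ≤ g) (hh : 0 ≤ h) (hk : k = g + h) (a : A) :
    T.L (cone k) a = T.L (cone h) (T.L (cone g) a) := by
  rw [hk, cone_add hg hh, T.L_add]

/-- The condition on the `g`-th coefficient of an element of `l₁(Γ, α, A)`: it lies in `A α_x(1)`
if `g = x ∈ Γ⁺`, and in `α_x(1) A` if `g = -x`, `x ∈ Γ⁺`. -/
def IsCoeff (S : DynamicalSystem A Γ) (g : Γ) (a : A) : Prop :=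
  (0 ≤ g → ∃ b, a = b * S.α (cone g) 1) ∧ (g ≤ 0 → ∃ b, a = S.α (cone (-g)) 1 * b)

lemma α_one_mul_one (S : DynamicalSystem A Γ) (x : Cone Γ) : S.α x 1 * S.α x 1 = S.α x 1 := by
  rw [← map_mul, one_mul]

lemma isCoeff_iff (S : DynamicalSystem A Γ) (g : Γ) (a : A) :
    IsCoeff S g a ↔ a * S.α (cone g) 1 = a ∧ S.α (cone (-g)) 1 * a = a := by
  constructor
  · rintro ⟨h1, h2⟩
    constructor
    · rcases le_total 0 g with hg | hg
      · obtain ⟨b, rfl⟩ := h1 hg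
        rw [mul_assoc, α_one_mul_one]
      · rw [cone_of_nonpos hg, S.α_zero, mul_one]
    · rcases le_total g 0 with hg | hg
      · obtain ⟨b, rfl⟩ := h2 hg
        rw [← mul_assoc, α_one_mul_one]
      · rw [cone_of_nonpos (neg_nonpos.2 hg), S.α_zero, one_mul]
  · rintro ⟨h1, h2⟩
    exact ⟨fun _ => ⟨a, h1.symm⟩, fun _ => ⟨a, h2.symm⟩⟩

section Coeff

variable {S : DynamicalSystem A Γ} (T : CompleteTransferAction S)

/-- The product `(a δ_g) (b δ_h) = c δ_{g+h}` in `l₁(Γ, α, A)`. -/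
def mulCoeff (g h : Γ) (a b : A) : A :=
  if 0 ≤ g + h then
    if h < 0 then a * S.α (cone (g + h)) b
    else if g < 0 then T.L (cone (-g)) (a * b)
    else a * S.α (cone g) b
  else
    if 0 < g then S.α (cone (-(g + h))) a * b
    else if 0 < h then T.L (cone h) (a * b)
    else S.α (cone (-h)) a * b

lemma mulCoeff_add_left (g h : Γ) (a a' b : A) :
    mulCoeff T g h (a + a') b = mulCoeff T g h a b + mulCoeff T g h a' b := by
  unfold mulCoeff; split_ifs <;> simp [add_mul]

lemma mulCoeff_add_right (g h : Γ) (a b b' : A) :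
    mulCoeff T g h a (b + b') = mulCoeff T g h a b + mulCoeff T g h a b' := by
  unfold mulCoeff; split_ifs <;> simp [mul_add]

lemma mulCoeff_smul_left (g h : Γ) (c : ℂ) (a b : A) :
    mulCoeff T g h (c • a) b = c • mulCoeff T g h a b := by
  unfold mulCoeff; split_ifs <;> simp

lemma mulCoeff_smul_right (g h : Γ) (c : ℂ) (a b : A) :
    mulCoeff T g h a (c • b) = c • mulCoeff T g h a b := by
  unfold mulCoeff; split_ifs <;> simp

lemma norm_mulCoeff_le (g h : Γ) (a b : A) : ‖mulCoeff T g h a b‖ ≤ ‖a‖ * ‖b‖ := by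
  have h1 (x : Cone Γ) : ‖a * S.α x b‖ ≤ ‖a‖ * ‖b‖ :=
    (norm_mul_le _ _).trans (by gcongr; exact S.α_norm_le _ _)
  have h2 (x : Cone Γ) : ‖S.α x a * b‖ ≤ ‖a‖ * ‖b‖ :=
    (norm_mul_le _ _).trans (by gcongr; exact S.α_norm_le _ _)
  have h3 (x : Cone Γ) : ‖T.L x (a * b)‖ ≤ ‖a‖ * ‖b‖ :=
    (T.norm_L_le _ _).trans (norm_mul_le _ _)
  unfold mulCoeff; split_ifs <;> apply_assumption

lemma mulCoeff_zero_left (g : Γ) (b : A) : mulCoeff T 0 g 1 b = if 0 ≤ g then b else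
    S.α (cone (-g)) 1 * b := by
  unfold mulCoeff
  rcases le_or_gt 0 g with hg | hg
  · simp [hg, not_lt.2 hg, cone_of_nonpos le_rfl, S.α_zero]
  · simp [not_le.2 hg, not_lt.2 hg.le]

lemma mulCoeff_one_left {g : Γ} {b : A} (hb : IsCoeff S g b) : mulCoeff T 0 g 1 b = b := by
  rw [mulCoeff_zero_left, ((isCoeff_iff S g b).1 hb).2, ite_self]

/-- The involution reverses products of homogeneous elements. -/
lemma star_mulCoeff (g h : Γ) (a b : A) :
    star (mulCoeff T g h a b) = mulCoeff T (-h) (-g) (star b) (star a) := by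
  rcases lt_trichotomy (g + h) 0 with hs | hs | hs
  · have hs' : 0 ≤ -h + -g := by rw [← neg_add_rev]; exact (neg_pos.2 hs).le
    unfold mulCoeff
    rw [if_neg (not_le.2 hs), if_pos hs']
    simp only [neg_lt_zero, neg_neg, neg_add_rev]
    split_ifs <;> simp [map_star, ← T.L_star]
  · obtain rfl : h = -g := (neg_eq_of_add_eq_zero_right hs).symm
    unfold mulCoeff
    simp only [add_neg_cancel, neg_neg, le_refl, if_true, neg_lt_zero]
    split_ifs with h1 h2
    · simp [cone_of_nonpos le_rfl, S.α_zero]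
    · simp [← T.L_star]
    · obtain rfl : g = 0 := le_antisymm (not_lt.1 h1) (not_lt.1 h2)
      simp [cone_of_nonpos le_rfl, S.α_zero]
  · have hs' : ¬ 0 ≤ -h + -g := by rw [← neg_add_rev]; exact not_le.2 (neg_neg_of_pos hs)
    unfold mulCoeff
    rw [if_pos hs.le, if_neg hs']
    simp only [neg_add_rev, neg_neg, Left.neg_pos_iff]
    split_ifs <;> simp [map_star, ← T.L_star]

lemma IsCoeff.star {g : Γ} {a : A} (ha : IsCoeff S g a) : IsCoeff S (-g) (star a) := by
  rw [isCoeff_iff] at ha ⊢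
  obtain ⟨h1, h2⟩ := ha
  rw [neg_neg]
  constructor
  · conv_rhs => rw [← h2]
    rw [star_mul, ← map_star, star_one]
  · conv_rhs => rw [← h1]
    rw [star_mul, ← map_star, star_one]


lemma mc1 {g h : Γ} (hs : 0 ≤ g + h) (hh : h ≤ 0) (a b : A) :
    mulCoeff T g h a b = a * S.α (cone (g + h)) b := by
  rcases hh.lt_or_eq with hh | rfl
  · rw [mulCoeff, if_pos hs, if_pos hh]
  · rw [add_zero] at hs
    simp [mulCoeff, not_lt.2 hs]

lemma mc3 {g h : Γ} (hg : 0 ≤ g) (hh : 0 ≤ h) (a b : A) :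
    mulCoeff T g h a b = a * S.α (cone g) b := by
  rw [mulCoeff, if_pos (add_nonneg hg hh), if_neg (not_lt.2 hh), if_neg (not_lt.2 hg)]

lemma mc2 {g h : Γ} (hs : 0 ≤ g + h) (hg : g ≤ 0) (a b : A) :
    mulCoeff T g h a b = T.L (cone (-g)) (a * b) := by
  have hh : 0 ≤ h := by grind
  rcases hg.lt_or_eq with hg | rfl
  · rw [mulCoeff, if_pos hs, if_neg (not_lt.2 hh), if_pos hg]
  · rw [mc3 T le_rfl hh, neg_zero, cone_of_nonpos le_rfl, S.α_zero, T.L_zero]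

lemma mc4 {g h : Γ} (hs : g + h ≤ 0) (hg : 0 ≤ g) (a b : A) :
    mulCoeff T g h a b = S.α (cone (-(g + h))) a * b := by
  rw [← star_inj, star_mulCoeff, mc1 T (by grind) (by grind), star_mul, ← map_star, neg_add_rev]

lemma mc5 {g h : Γ} (hs : g + h ≤ 0) (hh : 0 ≤ h) (a b : A) :
    mulCoeff T g h a b = T.L (cone h) (a * b) := by
  rw [← star_inj, star_mulCoeff, mc2 T (by grind) (by grind), neg_neg, ← T.L_star, star_mul]

lemma mc6 {g h : Γ} (hg : g ≤ 0) (hh : h ≤ 0) (a b : A) :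
    mulCoeff T g h a b = S.α (cone (-h)) a * b := by
  rw [← star_inj, star_mulCoeff, mc3 T (by grind) (by grind), star_mul, ← map_star]

lemma isCoeff_mulCoeff_aux {g h : Γ} {a b : A} (hb : IsCoeff S h b) (hs : 0 ≤ g + h) :
    IsCoeff S (g + h) (mulCoeff T g h a b) := by
  rw [isCoeff_iff] at hb ⊢
  refine ⟨?_, by rw [cone_of_nonpos (by grind : -(g + h) ≤ 0), S.α_zero, one_mul]⟩
  rcases le_total h 0 with hh | hh
  · rw [mc1 T hs hh, mul_assoc, ← map_mul, mul_one]
  rcases le_total g 0 with hg | hg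
  · rw [mc2 T hs hg, ← T.transfer', ← S.α_cone_add (by grind) hs (by grind : h = -g + (g + h)),
      mul_assoc, hb.1]
  · rw [mc3 T hg hh, mul_assoc, S.α_cone_add hg hh rfl, ← map_mul, hb.1]

lemma isCoeff_mulCoeff {g h : Γ} {a b : A} (ha : IsCoeff S g a) (hb : IsCoeff S h b) :
    IsCoeff S (g + h) (mulCoeff T g h a b) := by
  rcases le_total 0 (g + h) with hs | hs
  · exact isCoeff_mulCoeff_aux T hb hs
  · have := (isCoeff_mulCoeff_aux T (g := -h) (a := star b) ha.star (by grind)).star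
    rwa [← star_mulCoeff, star_star, neg_add_rev, neg_neg, neg_neg] at this

/-- `A α_x(1) ⊆ A α_y(1)` for `y ≤ x`. -/
lemma mul_α_one_of_le {x y : Γ} (hy : 0 ≤ y) (hxy : y ≤ x) {a : A} (ha : a * S.α (cone x) 1 = a) :
    a * S.α (cone y) 1 = a := by
  rw [S.α_cone_add hy (by grind) (by grind : x = y + (x - y))] at ha
  conv_lhs => rw [← ha]
  rw [mul_assoc, ← map_mul, mul_one, ha]

lemma mulCoeff_assoc_aux {x y z : Γ} {a b c : A} (ha : IsCoeff S x a) (hb : IsCoeff S y b)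
    (hc : IsCoeff S z c) (hs : 0 ≤ x + y + z) :
    mulCoeff T (x + y) z (mulCoeff T x y a b) c = mulCoeff T x (y + z) a (mulCoeff T y z b c) := by
  have hs' : 0 ≤ x + (y + z) := by rwa [← add_assoc]
  rw [isCoeff_iff] at ha hb hc
  rcases le_total 0 z with hz | hz
  · rcases le_total 0 y with hy | hy
    · rcases le_total 0 x with hx | hx
      · rw [mc3 T hx hy, mc3 T (add_nonneg hx hy) hz, mc3 T hy hz, mc3 T hx (add_nonneg hy hz),
          S.α_cone_add hx hy rfl, map_mul, mul_assoc]
      · rw [mc3 T hy hz, mc2 T hs' hx]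
        rcases le_total 0 (x + y) with hp | hp
        · rw [mc2 T hp hx, mc3 T hp hz, ← T.transfer',
            ← S.α_cone_add (by grind) hp (by grind : y = -x + (x + y)), mul_assoc]
        · rw [mc5 T hp hy, mc2 T hs hp, ← T.transfer',
            ← T.L_cone_add hy (by grind) (by grind : -x = y + -(x + y)), mul_assoc]
    · rcases le_total 0 x with hx | hx
      · rcases le_total 0 (x + y) with hp | hp
        · rw [mc1 T hp hy, mc3 T hp hz]
          rcases le_total 0 (y + z) with hq | hq
          · rw [mc2 T hq hy, mc3 T hx hq,
              S.α_cone_add hp (by grind) (by grind : x = (x + y) + -y), T.complete, ← mul_assoc,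
              hb.2, mul_assoc b, mul_α_one_of_le (by grind) (by grind : -y ≤ z) hc.1, map_mul,
              mul_assoc]
          · rw [mc5 T hq hz, mc1 T hs' hq,
              S.α_cone_add hp hz (by grind : x + (y + z) = (x + y) + z), T.complete, mul_assoc,
              mul_assoc, mul_assoc b, hc.1, map_mul,
              ← S.α_cone_add hp hz (by grind : x + (y + z) = (x + y) + z),
              ← mul_assoc a (S.α (cone (x + (y + z))) 1),
              mul_α_one_of_le hs' (by grind) ha.1, map_mul]
        · rw [mc4 T hp hx, mc2 T hs hp, mul_assoc, T.transfer]
          rcases le_total 0 (y + z) with hq | hq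
          · rw [mc2 T hq hy, mc3 T hx hq,
              T.L_cone_add (by grind) hx (by grind : -y = -(x + y) + x), T.complete, mul_assoc,
              ← T.transfer', ← mul_assoc, ha.1,
              ← S.α_cone_add (by grind) hx (by grind : -y = -(x + y) + x), mul_assoc,
              mul_α_one_of_le (by grind) (by grind : -y ≤ z) hc.1]
          · rw [mc5 T hq hz, mc1 T hs' hq,
              T.L_cone_add (by grind) hs' (by grind : z = -(x + y) + (x + (y + z))), T.complete,
              mul_assoc, ← T.transfer', ← mul_assoc, mul_α_one_of_le hs' (by grind) ha.1,
              ← S.α_cone_add (by grind) hs' (by grind : z = -(x + y) + (x + (y + z))), mul_assoc,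
              hc.1]
      · have hp : x + y ≤ 0 := by grind
        have hq : 0 ≤ y + z := by grind
        rw [mc6 T hx hy, mc2 T hs hp, mc2 T hq hy, mc2 T hs' hx, ← T.transfer,
          ← T.L_cone_add (by grind) (by grind) (by grind : -(x + y) = -y + -x), mul_assoc]
  · rcases le_total 0 y with hy | hy
    · rcases le_total 0 x with hx | hx
      · rw [mc3 T hx hy, mc1 T hs hz]
        rcases le_total 0 (y + z) with hq | hq
        · rw [mc1 T hq hz, mc3 T hx hq, S.α_cone_add hx hq (by grind : x + y + z = x + (y + z)),
            map_mul, mul_assoc]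
        · rw [mc4 T hq hy, mc1 T hs' hq, map_mul,
            ← S.α_cone_add hs' (by grind) (by grind : x = x + (y + z) + -(y + z)), mul_assoc,
            ← add_assoc x]
      · have hp : 0 ≤ x + y := by grind
        have hq : 0 ≤ y + z := by grind
        rw [mc2 T hp hx, mc1 T hs hz, mc1 T hq hz, mc2 T hs' hx, ← T.transfer',
          ← S.α_cone_add (by grind) hs (by grind : y + z = -x + (x + y + z)), mul_assoc]
    · have hx : 0 ≤ x := by grind
      have hp : 0 ≤ x + y := by grind
      have hq : y + z ≤ 0 := by grind
      rw [mc1 T hp hy, mc1 T hs hz, mc6 T hy hz, mc1 T hs' hq, map_mul,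
        ← S.α_cone_add hs' (by grind) (by grind : x + y = x + (y + z) + -z), mul_assoc,
        ← add_assoc x]

lemma mulCoeff_assoc {x y z : Γ} {a b c : A} (ha : IsCoeff S x a) (hb : IsCoeff S y b)
    (hc : IsCoeff S z c) :
    mulCoeff T (x + y) z (mulCoeff T x y a b) c = mulCoeff T x (y + z) a (mulCoeff T y z b c) := by
  rcases le_total 0 (x + y + z) with hs | hs
  · exact mulCoeff_assoc_aux T ha hb hc hs
  · rw [← star_inj]
    simp only [star_mulCoeff, neg_add_rev]
    exact (mulCoeff_assoc_aux T hc.star hb.star ha.star (by grind)).symm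

end Coeff

/-- The Banach space of all absolutely summable families `a = (a_g)` of coefficients. -/
def l1Coeffs (S : DynamicalSystem A Γ) : Submodule ℂ (lp (fun _ : Γ => A) 1) where
  carrier := {a | ∀ g, IsCoeff S g (a g)}
  zero_mem' g := (isCoeff_iff S g _).2 ⟨zero_mul _, mul_zero _⟩
  add_mem' {a b} ha hb g := by
    have h1 := (isCoeff_iff S g _).1 (ha g)
    have h2 := (isCoeff_iff S g _).1 (hb g)
    rw [isCoeff_iff, lp.coeFn_add, Pi.add_apply, add_mul, mul_add, h1.1, h1.2, h2.1, h2.2]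
    exact ⟨rfl, rfl⟩
  smul_mem' c a ha g := by
    have h1 := (isCoeff_iff S g _).1 (ha g)
    rw [isCoeff_iff, lp.coeFn_smul, Pi.smul_apply, smul_mul_assoc, mul_smul_comm, h1.1, h1.2]
    exact ⟨rfl, rfl⟩

/-- The Banach `*`-algebra `l₁(Γ, α, A)`. -/
def L1 {S : DynamicalSystem A Γ} (_T : CompleteTransferAction S) : Type (max u v) := l1Coeffs S

namespace L1

variable {S : DynamicalSystem A Γ} {T : CompleteTransferAction S}

instance : NormedAddCommGroup (L1 T) := inferInstanceAs (NormedAddCommGroup (l1Coeffs S))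
instance : NormedSpace ℂ (L1 T) := inferInstanceAs (NormedSpace ℂ (l1Coeffs S))

/-- The `g`-th coefficient of an element of `l₁(Γ, α, A)`. -/
def coeff (a : L1 T) (g : Γ) : A := (Subtype.val (p := (· ∈ l1Coeffs S)) a) g

lemma isCoeff_coeff (a : L1 T) (g : Γ) : IsCoeff S g (a.coeff g) := a.2 g

@[ext] lemma ext {a b : L1 T} (h : ∀ g, a.coeff g = b.coeff g) : a = b :=
  Subtype.ext (lp.ext (funext h))

lemma coeff_add (a b : L1 T) (g : Γ) : (a + b).coeff g = a.coeff g + b.coeff g := rfl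
lemma coeff_smul (c : ℂ) (a : L1 T) (g : Γ) : (c • a).coeff g = c • a.coeff g := rfl
lemma coeff_zero (g : Γ) : (0 : L1 T).coeff g = 0 := rfl

lemma hasSum_norm (a : L1 T) : HasSum (fun g => ‖a.coeff g‖) ‖a‖ := by
  have h := lp.hasSum_norm (p := 1) (by simp) (Subtype.val (p := (· ∈ l1Coeffs S)) a)
  simpa using! h

lemma norm_coeff_le (a : L1 T) (g : Γ) : ‖a.coeff g‖ ≤ ‖a‖ :=
  le_hasSum a.hasSum_norm g fun _ _ => norm_nonneg _

/-- An element of `l₁(Γ, α, A)` from its family of coefficients. -/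
def mk (f : Γ → A) (h1 : ∀ g, IsCoeff S g (f g)) (h2 : Summable fun g => ‖f g‖) : L1 T :=
  ⟨⟨f, memℓp_gen (by simpa using h2)⟩, h1⟩

lemma coeff_mk (f : Γ → A) (h1 : ∀ g, IsCoeff S g (f g)) (h2 : Summable fun g => ‖f g‖) (g : Γ) :
    (mk f h1 h2 : L1 T).coeff g = f g := rfl

/-- The coefficient map as a continuous linear map. -/
def coeffCLM (g : Γ) : L1 T →L[ℂ] A :=
  LinearMap.mkContinuous
    { toFun := fun a => a.coeff g, map_add' := fun _ _ => rfl, map_smul' := fun _ _ => rfl } 1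
    fun a => by rw [one_mul]; exact norm_coeff_le a g

instance : CompleteSpace (L1 T) := by
  have h : IsClosed (l1Coeffs S : Set (lp (fun _ : Γ => A) 1)) := by
    have h0 (g : Γ) : Continuous fun a : lp (fun _ : Γ => A) 1 => a g :=
      (continuous_apply g).comp (lp.uniformContinuous_coe (p := 1)).continuous
    have : (l1Coeffs S : Set (lp (fun _ : Γ => A) 1)) =
        ⋂ g, ({a | a g * S.α (cone g) 1 = a g} ∩ {a | S.α (cone (-g)) 1 * a g = a g}) := by
      ext a
      simp only [Set.mem_iInter, Set.mem_inter_iff, Set.mem_ofPred_eq, ← isCoeff_iff]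
      rfl
    rw [this]
    exact isClosed_iInter fun g =>
      (isClosed_eq ((h0 g).mul continuous_const) (h0 g)).inter
        (isClosed_eq (continuous_const.mul (h0 g)) (h0 g))
  exact h.completeSpace_coe

section Mul

/-- The `g`-th coefficient of the product `a b`: the sum of all the products
`(a_x δ_x) (b_y δ_y)` with `x + y = g`. -/
def mulFun (a b : L1 T) (g : Γ) : A := ∑' x, mulCoeff T x (g - x) (a.coeff x) (b.coeff (g - x))

lemma summable_mul (a b : L1 T) : HasSum (fun p : Γ × Γ => ‖a.coeff p.2‖ * ‖b.coeff (p.1 - p.2)‖)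
    (‖a‖ * ‖b‖) := by
  have h0 : Summable fun p : Γ × Γ => ‖a.coeff p.1‖ * ‖b.coeff p.2‖ :=
    Summable.mul_of_nonneg a.hasSum_norm.summable b.hasSum_norm.summable
      (fun _ => norm_nonneg _) (fun _ => norm_nonneg _)
  have h : HasSum (fun p : Γ × Γ => ‖a.coeff p.1‖ * ‖b.coeff p.2‖) (‖a‖ * ‖b‖) :=
    HasSum.mul (f := fun g => ‖a.coeff g‖) (g := fun g => ‖b.coeff g‖)
      a.hasSum_norm b.hasSum_norm h0
  let e : Γ × Γ ≃ Γ × Γ :=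
    { toFun := fun p => (p.2, p.1 - p.2)
      invFun := fun p => (p.1 + p.2, p.1)
      left_inv := fun p => by simp
      right_inv := fun p => by simp }
  have h' := (e.hasSum_iff (f := fun p : Γ × Γ => ‖a.coeff p.1‖ * ‖b.coeff p.2‖)).2 h
  exact h'

lemma summable_mulCoeff_prod (a b : L1 T) : Summable fun p : Γ × Γ =>
    ‖mulCoeff T p.2 (p.1 - p.2) (a.coeff p.2) (b.coeff (p.1 - p.2))‖ :=
  Summable.of_nonneg_of_le (fun _ => norm_nonneg _) (fun _ => norm_mulCoeff_le T _ _ _ _)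
    (summable_mul a b).summable

lemma summable_norm_mulCoeff (a b : L1 T) (g : Γ) :
    Summable fun x => ‖mulCoeff T x (g - x) (a.coeff x) (b.coeff (g - x))‖ :=
  (summable_mulCoeff_prod a b).prod_factor g

lemma summable_mulCoeff (a b : L1 T) (g : Γ) :
    Summable fun x => mulCoeff T x (g - x) (a.coeff x) (b.coeff (g - x)) :=
  (summable_norm_mulCoeff a b g).of_norm

lemma norm_mulFun_le (a b : L1 T) (g : Γ) : ‖mulFun a b g‖ ≤
    ∑' x, ‖mulCoeff T x (g - x) (a.coeff x) (b.coeff (g - x))‖ :=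
  norm_tsum_le_tsum_norm (summable_norm_mulCoeff a b g)

lemma summable_mulFun (a b : L1 T) : Summable fun g => ‖mulFun a b g‖ :=
  Summable.of_nonneg_of_le (fun _ => norm_nonneg _) (norm_mulFun_le a b)
    (summable_mulCoeff_prod a b).prod

lemma isCoeff_mulFun (a b : L1 T) (g : Γ) : IsCoeff S g (mulFun a b g) := by
  have h (x : Γ) := (isCoeff_iff S _ _).1
    (isCoeff_mulCoeff T (a.isCoeff_coeff x) (b.isCoeff_coeff (g - x)))
  simp only [add_sub_cancel] at h
  rw [isCoeff_iff]
  constructor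
  · rw [mulFun, ← (summable_mulCoeff a b g).tsum_mul_right]
    exact tsum_congr fun x => (h x).1
  · rw [mulFun, ← (summable_mulCoeff a b g).tsum_mul_left]
    exact tsum_congr fun x => (h x).2

instance : Mul (L1 T) := ⟨fun a b => mk (mulFun a b) (isCoeff_mulFun a b) (summable_mulFun a b)⟩

lemma coeff_mul (a b : L1 T) (g : Γ) : (a * b).coeff g =
    ∑' x, mulCoeff T x (g - x) (a.coeff x) (b.coeff (g - x)) := rfl

lemma norm_mul_le' (a b : L1 T) : ‖a * b‖ ≤ ‖a‖ * ‖b‖ := by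
  rw [← (a * b).hasSum_norm.tsum_eq, ← (summable_mul a b).tsum_eq,
    (summable_mul a b).summable.tsum_prod]
  have h (g : Γ) := (summable_mul a b).summable.prod_factor g
  refine (summable_mulFun a b).tsum_le_tsum (fun g => ?_) (summable_mul a b).summable.prod
  exact (norm_mulFun_le a b g).trans
    ((summable_norm_mulCoeff a b g).tsum_le_tsum (fun x => norm_mulCoeff_le T _ _ _ _) (h g))

lemma add_mul' (a b c : L1 T) : (a + b) * c = a * c + b * c := by
  ext g
  rw [coeff_add, coeff_mul, coeff_mul, coeff_mul,
    ← (summable_mulCoeff a c g).tsum_add (summable_mulCoeff b c g)]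
  exact tsum_congr fun x => mulCoeff_add_left T _ _ _ _ _

lemma mul_add' (a b c : L1 T) : a * (b + c) = a * b + a * c := by
  ext g
  rw [coeff_add, coeff_mul, coeff_mul, coeff_mul,
    ← (summable_mulCoeff a b g).tsum_add (summable_mulCoeff a c g)]
  exact tsum_congr fun x => mulCoeff_add_right T _ _ _ _ _

lemma smul_mul' (r : ℂ) (a b : L1 T) : (r • a) * b = r • (a * b) := by
  ext g
  rw [coeff_smul, coeff_mul, coeff_mul, ← (summable_mulCoeff a b g).tsum_const_smul]
  exact tsum_congr fun x => mulCoeff_smul_left T _ _ _ _ _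

lemma mul_smul' (r : ℂ) (a b : L1 T) : a * (r • b) = r • (a * b) := by
  ext g
  rw [coeff_smul, coeff_mul, coeff_mul, ← (summable_mulCoeff a b g).tsum_const_smul]
  exact tsum_congr fun x => mulCoeff_smul_right T _ _ _ _ _

/-- The multiplication as a bounded bilinear map. -/
def mulCLM : L1 T →L[ℂ] L1 T →L[ℂ] L1 T :=
  LinearMap.mkContinuous₂ (LinearMap.mk₂ ℂ (fun a b : L1 T => a * b) add_mul' smul_mul' mul_add'
    mul_smul') 1 fun a b => by rw [one_mul]; exact norm_mul_le' a b

lemma mulCLM_apply (a b : L1 T) : mulCLM a b = a * b := rfl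

end Mul

section Single

open Classical in
/-- The element `a δ_g` of `l₁(Γ, α, A)`. -/
def single (g : Γ) (a : A) (ha : IsCoeff S g a) : L1 T :=
  ⟨lp.single 1 g a, fun h => by
    rw [lp.coeFn_single, Pi.single_apply]
    split_ifs with hh
    · rw [hh]; exact ha
    · exact (isCoeff_iff S h _).2 ⟨zero_mul _, mul_zero _⟩⟩

open Classical in
lemma coeff_single (g : Γ) (a : A) (ha : IsCoeff S g a) (h : Γ) :
    (single g a ha : L1 T).coeff h = if h = g then a else 0 := by
  change (lp.single 1 g a : lp (fun _ : Γ => A) 1) h = _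
  rw [lp.coeFn_single, Pi.single_apply]

lemma hasSum_single (a : L1 T) :
    HasSum (fun g => (single g (a.coeff g) (a.isCoeff_coeff g) : L1 T)) a := by
  classical
  have h := lp.hasSum_single (p := 1) (by simp) (Subtype.val (p := (· ∈ l1Coeffs S)) a)
  have hi : Topology.IsInducing (Subtype.val (p := (· ∈ l1Coeffs S))) :=
    Topology.IsInducing.subtypeVal
  refine (hi.hasSum_iff (g := (l1Coeffs S).subtype) _ _).1 ?_
  convert! h

lemma clm_ext {E : Type*} [NormedAddCommGroup E] [NormedSpace ℂ E] {f f' : L1 T →L[ℂ] E}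
    (h : ∀ g a ha, f (single g a ha) = f' (single g a ha)) : f = f' := by
  ext a
  have h1 := a.hasSum_single.mapL f
  have h2 := a.hasSum_single.mapL f'
  simp only [h] at h1
  exact h1.unique h2

lemma single_mul_single (g h : Γ) (a b : A) (ha : IsCoeff S g a) (hb : IsCoeff S h b) :
    (single g a ha * single h b hb : L1 T) =
      single (g + h) (mulCoeff T g h a b) (isCoeff_mulCoeff T ha hb) := by
  ext k
  have h0 (x y : Γ) (c : A) : mulCoeff T x y 0 c = 0 := by
    simpa using mulCoeff_smul_left T x y 0 0 c
  have h0' (x y : Γ) (c : A) : mulCoeff T x y c 0 = 0 := by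
    simpa using mulCoeff_smul_right T x y 0 c 0
  rw [coeff_mul, tsum_eq_single g, coeff_single, coeff_single, coeff_single, if_pos rfl]
  · by_cases hk : k = g + h
    · rw [if_pos hk, if_pos (by grind), hk, add_sub_cancel_left]
    · rw [if_neg hk, if_neg (by grind), h0']
  · intro x hx
    rw [coeff_single, if_neg hx, h0]

lemma mul_assoc' (a b c : L1 T) : a * b * c = a * (b * c) := by
  have h3 (g h k : Γ) (a b c : A) (ha : IsCoeff S g a) (hb : IsCoeff S h b) (hc : IsCoeff S k c) :
      (single g a ha * single h b hb * single k c hc : L1 T) =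
        single g a ha * (single h b hb * single k c hc) := by
    simp only [single_mul_single]
    ext l
    rw [coeff_single, coeff_single, add_assoc, mulCoeff_assoc T ha hb hc]
  have h2 (g h : Γ) (a b : A) (ha : IsCoeff S g a) (hb : IsCoeff S h b) (c : L1 T) :
      (single g a ha * single h b hb * c : L1 T) = single g a ha * (single h b hb * c) :=
    congrArg (fun f : L1 T →L[ℂ] L1 T => f c) (clm_ext
      (f := mulCLM (single g a ha * single h b hb : L1 T))
      (f' := (mulCLM (single g a ha : L1 T)).comp (mulCLM (single h b hb : L1 T)))
      fun k c hc => h3 g h k a b c ha hb hc)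
  have h1 (g : Γ) (a : A) (ha : IsCoeff S g a) (b c : L1 T) :
      (single g a ha * b * c : L1 T) = single g a ha * (b * c) :=
    congrArg (fun f : L1 T →L[ℂ] L1 T => f b) (clm_ext
      (f := (mulCLM.flip c).comp (mulCLM (single g a ha : L1 T)))
      (f' := (mulCLM (single g a ha : L1 T)).comp (mulCLM.flip c))
      fun h b hb => h2 g h a b ha hb c)
  exact congrArg (fun f : L1 T →L[ℂ] L1 T => f a) (clm_ext
      (f := (mulCLM.flip c).comp (mulCLM.flip b)) (f' := mulCLM.flip (b * c))
      fun g a ha => h1 g a ha b c)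

lemma isCoeff_one : IsCoeff S 0 1 := by
  rw [isCoeff_iff, neg_zero, cone_of_nonpos le_rfl, S.α_zero, one_mul]
  exact ⟨rfl, rfl⟩

instance : One (L1 T) := ⟨single 0 1 isCoeff_one⟩

lemma one_def : (1 : L1 T) = single 0 1 isCoeff_one := rfl

lemma one_mul' (a : L1 T) : 1 * a = a :=
  congrArg (fun f : L1 T →L[ℂ] L1 T => f a) (clm_ext
    (f := mulCLM (1 : L1 T)) (f' := ContinuousLinearMap.id ℂ _) fun g a ha => by
      rw [mulCLM_apply, one_def, single_mul_single, ContinuousLinearMap.id_apply]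
      ext h
      rw [coeff_single, coeff_single, zero_add, mulCoeff_one_left T ha])

end Single

section Star

instance : Star (L1 T) := ⟨fun a => mk (fun g => star (a.coeff (-g)))
  (fun g => by simpa using (a.isCoeff_coeff (-g)).star)
  (by simpa using! ((Equiv.neg Γ).summable_iff (f := fun g => ‖a.coeff g‖)).2
        a.hasSum_norm.summable)⟩

lemma coeff_star (a : L1 T) (g : Γ) : (star a).coeff g = star (a.coeff (-g)) := rfl

lemma star_star' (a : L1 T) : star (star a) = a := by
  ext g; rw [coeff_star, coeff_star, neg_neg, star_star]

lemma star_mul' (a b : L1 T) : star (a * b) = star b * star a := by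
  ext g
  rw [coeff_star, coeff_mul, coeff_mul, ← (Equiv.subRight g).tsum_eq, tsum_star]
  refine tsum_congr fun x => ?_
  rw [star_mulCoeff, Equiv.subRight_apply, coeff_star, coeff_star]
  congr 3 <;> abel

lemma mul_one' (a : L1 T) : a * 1 = a := by
  have h1 : star (1 : L1 T) = 1 := by
    ext g
    simp only [one_def, coeff_star, coeff_single, neg_eq_zero]
    split_ifs <;> simp
  rw [← star_star' (a * 1), star_mul', h1, one_mul', star_star']

end Star

instance : NormedRing (L1 T) where
  __ := (inferInstance : NormedAddCommGroup (L1 T))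
  mul_assoc := mul_assoc'
  one_mul := one_mul'
  mul_one := mul_one'
  left_distrib := mul_add'
  right_distrib := add_mul'
  zero_mul a := by simpa using smul_mul' 0 0 a
  mul_zero a := by simpa using mul_smul' 0 a 0
  norm_mul_le := norm_mul_le'

instance : NormedAlgebra ℂ (L1 T) where
  __ := Algebra.ofModule smul_mul' mul_smul'
  norm_smul_le := norm_smul_le

instance : StarRing (L1 T) where
  star_involutive := star_star'
  star_mul := star_mul'
  star_add a b := by ext g; simp only [coeff_star, coeff_add, star_add]

instance : StarModule ℂ (L1 T) where
  star_smul c a := by ext g; simp only [coeff_star, coeff_smul, star_smul]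

instance : NormedStarGroup (L1 T) where
  norm_star_le a := by
    rw [← a.hasSum_norm.tsum_eq, ← (star a).hasSum_norm.tsum_eq]
    simp only [coeff_star, norm_star]
    exact ((Equiv.neg Γ).tsum_eq fun g => ‖a.coeff g‖).le

end L1

section CrossedProductDefs

variable {S : DynamicalSystem A Γ} (T : CompleteTransferAction S)

/-- The crossed product `A ⋊_α Γ`: the enveloping `C^*`-algebra of `l₁(Γ, α, A)`. -/
abbrev CrossedProductAlgebra : Type (max u v) := Enveloping.EnvelopingAlgebra (L1 T)

variable {H : Type*} [NormedAddCommGroup H] [InnerProductSpace ℂ H] [CompleteSpace H]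

/-- Covariant representations `(π, U, H)` of `(A, Γ⁺, α)`; a representation of a unital algebra is
non-degenerate iff it is unital. -/
structure IsCovariant (π : A →⋆ₐ[ℂ] (H →L[ℂ] H)) (U : Cone Γ → (H →L[ℂ] H)) : Prop where
  U_zero : U 0 = 1
  U_add : ∀ x y, U (x + y) = U x * U y
  conj : ∀ x a, U x * π a * star (U x) = π (S.α x a)
  conj' : ∀ x a, star (U x) * π a * U x = π (T.L x a)

variable (S) in
/-- Property (*): `‖E_0(a)‖ ≤ ‖(π × U)(a)‖` for all
`a = ∑_{x ∈ F} u_x^* a_{-x} + a_0 + ∑_{x ∈ F} a_x u_x`, where `F ⊆ Γ⁺ ∖ {0}` is finite,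
`a_x ∈ A α_x(1)` and `a_{-x} ∈ α_x(1) A`, and where `E_0(a) = a_0`. -/
def PropertyStar (π : A →⋆ₐ[ℂ] (H →L[ℂ] H)) (U : Cone Γ → (H →L[ℂ] H)) : Prop :=
  ∀ (F : Finset (Cone Γ)) (a : Γ → A), 0 ∉ F → (∀ g, IsCoeff S g (a g)) →
    ‖a 0‖ ≤ ‖∑ x ∈ F, star (U x) * π (a (-(x : Γ))) + π (a 0) + ∑ x ∈ F, π (a x) * U x‖

/-- The representation `Φ` of `A ⋊_α Γ` is the one induced by `(π, U)`, that is, on (the image of)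
`l₁(Γ, α, A)` it is `∑_{x > 0} U_x^* π(a_{-x}) + π(a_0) + ∑_{x > 0} π(a_x) U_x`. -/
def IsInduced (π : A →⋆ₐ[ℂ] (H →L[ℂ] H)) (U : Cone Γ → (H →L[ℂ] H))
    (Φ : CrossedProductAlgebra T →⋆ₐ[ℂ] (H →L[ℂ] H)) : Prop :=
  ∀ a : L1 T, HasSum (fun g : Γ => if 0 ≤ g then π (a.coeff g) * U (cone g)
    else star (U (cone (-g))) * π (a.coeff g)) (Φ (Enveloping.EnvelopingAlgebra.ι (L1 T) a))

end CrossedProductDefs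

section Regular

variable {S : DynamicalSystem A Γ} (T : CompleteTransferAction S)

/-- The algebra `A` with the semi-inner product `⟨·,·⟩_g` of a positive functional `f`. -/
def PreH (_T : CompleteTransferAction S) (_f : A →ₚ[ℂ] ℂ) (_g : Γ) : Type u := A

namespace PreH

variable {T} {f : A →ₚ[ℂ] ℂ} {g : Γ}

instance : AddCommGroup (PreH T f g) := inferInstanceAs (AddCommGroup A)
instance : Module ℂ (PreH T f g) := inferInstanceAs (Module ℂ A)

variable (T f g) in
/-- The identity map of `A`, with the type of its target changed. -/
def of : A ≃ₗ[ℂ] PreH T f g := LinearEquiv.refl ℂ A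

/-- The semi-inner product `f(L_g(u^* v))` if `0 ≤ g`, and `f(u^* α_{-g}(1) v)` if `g ≤ 0`; it is
conjugate linear in `u` and linear in `v`. -/
def form (T : CompleteTransferAction S) (f : A →ₚ[ℂ] ℂ) (g : Γ) (u v : A) : ℂ :=
  if 0 ≤ g then f (T.L (cone g) (star u * v)) else f (star u * S.α (cone (-g)) 1 * v)

lemma form_symm (u v : A) : star (form T f g v u) = form T f g u v := by
  unfold form
  split_ifs
  · rw [← map_star f, ← T.L_star, star_mul, star_star]
  · rw [← map_star f, star_mul, star_mul, ← map_star, star_one, star_star, mul_assoc]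

lemma form_add (u v w : A) : form T f g (u + v) w = form T f g u w + form T f g v w := by
  unfold form
  split_ifs <;> simp [add_mul]

lemma form_smul (c : ℂ) (u v : A) : form T f g (c • u) v = star c * form T f g u v := by
  unfold form
  split_ifs <;> simp

lemma form_nonneg (v : A) : 0 ≤ form T f g v v := by
  unfold form
  split_ifs
  · exact f.map_nonneg (T.nonneg _ _ (star_mul_self_nonneg v))
  · have h : star v * S.α (cone (-g)) 1 * v =
        star (S.α (cone (-g)) 1 * v) * (S.α (cone (-g)) 1 * v) := by
      rw [star_mul, ← map_star, star_one, mul_assoc, mul_assoc, ← mul_assoc (S.α _ 1),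
        α_one_mul_one]
    rw [h]
    exact f.map_nonneg (star_mul_self_nonneg _)

/-- The semi-inner product as Mathlib's structure. -/
abbrev core (T : CompleteTransferAction S) (f : A →ₚ[ℂ] ℂ) (g : Γ) :
    PreInnerProductSpace.Core ℂ (PreH T f g) where
  inner u v := form (A := A) T f g u v
  conj_inner_symm u v := form_symm (A := A) (T := T) (f := f) (g := g) u v
  re_inner_nonneg v := RCLike.nonneg_iff.mp (form_nonneg (A := A) (T := T) (f := f) (g := g) v) |>.1
  add_left u v w := form_add (A := A) (T := T) (f := f) (g := g) u v w
  smul_left u v c := form_smul (A := A) (T := T) (f := f) (g := g) c u v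

instance : SeminormedAddCommGroup (PreH T f g) :=
  InnerProductSpace.Core.toSeminormedAddCommGroup (c := core T f g)
instance : InnerProductSpace ℂ (PreH T f g) := InnerProductSpace.ofCore (core T f g)

lemma inner_of (u v : A) : inner ℂ (of T f g u) (of T f g v) = form T f g u v := rfl

end PreH

/-- The Hilbert space generated by the semi-inner product `⟨·,·⟩_g` of `f`. -/
abbrev HilbertPiece (f : A →ₚ[ℂ] ℂ) (g : Γ) : Type u := UniformSpace.Completion (PreH T f g)

/-- The Hilbert space of the regular representation: the Hilbert direct sum, over all positive
functionals `f` on `A`, of the Hilbert direct sums over `g ∈ Γ` of the spaces `H_g^f`. -/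
abbrev RegularSpace : Type (max u v) :=
  lp (fun f : A →ₚ[ℂ] ℂ => lp (fun g : Γ => HilbertPiece T f g) 2) 2

open Classical in
/-- The class of `v ∈ A` in the summand `H_g^f` of the space of the regular representation. -/
def vec (f : A →ₚ[ℂ] ℂ) (g : Γ) (v : A) : RegularSpace T :=
  lp.single 2 f (lp.single 2 g ((PreH.of T f g v : PreH T f g) : HilbertPiece T f g))

/-- The formulas that define the operators `U_x` and `π(a)` on the regular space. They are stated
for the vectors that are concentrated in a single summand and come from `A`; the span of these is
dense. -/
structure IsRegular (π : A →⋆ₐ[ℂ] (RegularSpace T →L[ℂ] RegularSpace T))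
    (U : Cone Γ → (RegularSpace T →L[ℂ] RegularSpace T)) : Prop where
  π_apply : ∀ (a : A) (f : A →ₚ[ℂ] ℂ) (g : Γ) (v : A),
    π a (vec T f g v) = vec T f g (if 0 ≤ g then a * v else S.α (cone (-g)) a * v)
  U_apply : ∀ (x : Cone Γ) (f : A →ₚ[ℂ] ℂ) (g : Γ) (v : A),
    U x (vec T f (g - x) v) = vec T f g
      (if (x : Γ) ≤ g then S.α x v
        else if 0 ≤ g then S.α x 1 * S.α (cone g) v
        else S.α (cone (x - g)) 1 * v)

end Regular

end CrossedProduct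

end

/-! The formulas for `π(a)` and `U_x` are linear maps of `A` that are bounded for the semi-inner
products, so they extend to the completed summands and then to the Hilbert sum. Since the vectors
`vec T f g v` span a dense subspace, uniqueness and all operator identities are checked on them.
Covariance rests on the adjoint of the shift: `U_x^*` takes the class of `v` in degree `g` to the
class of `L_y(v)` in degree `g - x`, where `y` is the positive part of `min x g`
(`star_shiftOp_vec`).

A covariant pair sends `a δ_g` to an operator `inducedOp π U g a` of norm at most `‖a‖`. By
covariance these operators multiply and star like the homogeneous elements of `l₁(Γ, α, A)`
(`IsCovariant.inducedOp_mul`, `IsCovariant.star_inducedOp`). Summation gives a representation of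
`l₁(Γ, α, A)`, which extends to the enveloping `C^*`-algebra by density.

The decisive estimate is `‖a_0‖ ≤ ‖ρ(a)‖` for the regular representation `ρ`
(`norm_coeff_zero_le_norm_regularRep`). A positive functional `f` attaining the norm of `a_0` gives
the vectors `1` and `a_0` in degree `0` of the summand of `f`. The term of `ρ(a)` of degree `g`
moves degree `0` to degree `g`, so pairing `ρ(a) 1` with `a_0` leaves `f(a_0^* a_0) = ‖a_0‖²`. For
finite sums this is property (*).

The same estimate implies faithfulness. Applied to `a a^*` it bounds every coefficient of `a` by
`‖ρ(a)‖` (`L1.norm_coeff_sq_le`), so an element with finite support has `ℓ¹`-norm at most the size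
of its support times `‖ρ(a)‖`. For `b = a a^*`, the support of `b ^ k` grows only polynomially in
`k`, because `Γ` is abelian (`L1.exists_support_pow`). Comparing the enveloping norm with the
`ℓ¹`-norm on `b ^ 2 ^ n` and letting `n` grow removes the polynomial factor, hence the enveloping
norm is at most `‖ρ(a)‖` (`norm_ι_le_of_finite_support`). Finitely supported elements are dense. -/

noncomputable section

open scoped ComplexOrder

set_option linter.unusedSectionVars false

/-! ### Operators on Hilbert sums that permute the summands. -/

section LpMap

variable {ι : Type*} {G : ι → Type*} [∀ i, NormedAddCommGroup (G i)] [∀ i, NormedSpace ℂ (G i)]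

lemma lp_two_hasSum_sq (ξ : lp G 2) : HasSum (fun i => ‖ξ i‖ ^ 2) (‖ξ‖ ^ 2) := by
  simpa using! lp.hasSum_norm (p := 2) (by simp) ξ

section

variable {σ : ι → ι} (V : ∀ i, G (σ i) →L[ℂ] G i) {C : ℝ}

lemma norm_sq_apply_le (hV : ∀ i, ‖V i‖ ≤ C) (ξ : lp G 2) (i : ι) :
    ‖V i (ξ (σ i))‖ ^ 2 ≤ C ^ 2 * ‖ξ (σ i)‖ ^ 2 := by
  rw [← mul_pow]
  exact pow_le_pow_left₀ (norm_nonneg _) ((V i).le_of_opNorm_le (hV i) _) 2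

lemma summable_sq_comp (hσ : Function.Injective σ) (C : ℝ) (ξ : lp G 2) :
    Summable fun i => C ^ 2 * ‖ξ (σ i)‖ ^ 2 :=
  ((lp_two_hasSum_sq ξ).summable.comp_injective hσ).mul_left _

variable (hσ : Function.Injective σ) (hV : ∀ i, ‖V i‖ ≤ C)

/-- The operator `ξ ↦ (i ↦ V_i ξ_{σ i})` on an `ℓ²`-direct sum, as a linear map. -/
def lpMapLinear : lp G 2 →ₗ[ℂ] lp G 2 where
  toFun ξ := ⟨fun i => V i (ξ (σ i)), memℓp_gen (by
    simpa using! (summable_sq_comp hσ C ξ).of_nonneg_of_le (fun _ => sq_nonneg _)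
      (norm_sq_apply_le V hV ξ))⟩
  map_add' ξ η := lp.ext (funext fun i => map_add (V i) (ξ (σ i)) (η (σ i)))
  map_smul' c ξ := lp.ext (funext fun i => map_smul (V i) c (ξ (σ i)))

lemma lpMapLinear_apply (ξ : lp G 2) (i : ι) :
    lpMapLinear V hσ hV ξ i = V i (ξ (σ i)) := rfl

lemma norm_lpMapLinear_le (hC : 0 ≤ C) (ξ : lp G 2) : ‖lpMapLinear V hσ hV ξ‖ ≤ C * ‖ξ‖ := by
  have h1 := lp_two_hasSum_sq (lpMapLinear V hσ hV ξ)
  have h2 := lp_two_hasSum_sq ξ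
  simp only [lpMapLinear_apply] at h1
  -- As `σ` is injective, each coordinate of `ξ` is counted at most once.
  have h3 : ∑' i, C ^ 2 * ‖ξ (σ i)‖ ^ 2 ≤ C ^ 2 * ‖ξ‖ ^ 2 := by
    rw [tsum_mul_left, ← h2.tsum_eq]
    exact mul_le_mul_of_nonneg_left
      (tsum_comp_le_tsum_of_inj h2.summable (fun _ => sq_nonneg _) hσ) (sq_nonneg _)
  rw [← sq_le_sq₀ (norm_nonneg _) (by positivity), mul_pow]
  exact (hasSum_le (norm_sq_apply_le V hV ξ) h1 (summable_sq_comp hσ C ξ).hasSum).trans h3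

/-- The operator `ξ ↦ (i ↦ V_i ξ_{σ i})` on an `ℓ²`-direct sum. -/
def lpMap (hC : 0 ≤ C) : lp G 2 →L[ℂ] lp G 2 :=
  (lpMapLinear V hσ hV).mkContinuous C (norm_lpMapLinear_le V hσ hV hC)

end

lemma lpMap_apply {σ : ι → ι} (hσ : Function.Injective σ) (V : ∀ i, G (σ i) →L[ℂ] G i) {C : ℝ}
    (hC : 0 ≤ C) (hV : ∀ i, ‖V i‖ ≤ C) (ξ : lp G 2) (i : ι) :
    lpMap V hσ hV hC ξ i = V i (ξ (σ i)) := rfl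

lemma lpMap_single [DecidableEq ι] {σ : ι → ι} (hσ : Function.Injective σ)
    (V : ∀ i, G (σ i) →L[ℂ] G i) {C : ℝ} (hC : 0 ≤ C) (hV : ∀ i, ‖V i‖ ≤ C) (i : ι) (v : G (σ i)) :
    lpMap V hσ hV hC (lp.single 2 (σ i) v) = lp.single 2 i (V i v) := by
  ext j
  rw [lpMap_apply]
  by_cases h : j = i
  · subst h; simp
  · rw [lp.single_apply_ne _ _ _ h, lp.single_apply_ne _ _ _ (hσ.ne h), map_zero]

lemma norm_lpMap_le {σ : ι → ι} (hσ : Function.Injective σ) (V : ∀ i, G (σ i) →L[ℂ] G i) {C : ℝ}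
    (hC : 0 ≤ C) (hV : ∀ i, ‖V i‖ ≤ C) : ‖lpMap V hσ hV hC‖ ≤ C :=
  LinearMap.mkContinuous_norm_le _ hC _

end LpMap

/-! ### Operators on the regular space, given by linear maps of `A`. -/

namespace CrossedProduct

universe u v

variable {A : Type u} [CStarAlgebra A] {Γ : Type v} [AddCommGroup Γ] [LinearOrder Γ]
  [IsOrderedAddMonoid Γ] [PartialOrder A] [StarOrderedRing A]
  {S : DynamicalSystem A Γ} {T : CompleteTransferAction S}

open PreH

lemma form_of_nonneg {g : Γ} (h : 0 ≤ g) (f : A →ₚ[ℂ] ℂ) (u v : A) :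
    form T f g u v = f (T.L (cone g) (star u * v)) := if_pos h

/-- At `g = 0` both formulas reduce to `f(u^* v)`, as `L_0` and `α_0` are the identity. Hence case
distinctions on the sign of `g` may overlap at `0`. -/
lemma form_of_nonpos {g : Γ} (h : g ≤ 0) (f : A →ₚ[ℂ] ℂ) (u v : A) :
    form T f g u v = f (star u * S.α (cone (-g)) 1 * v) := by
  rcases h.lt_or_eq with h | rfl
  · exact if_neg h.not_ge
  · rw [form_of_nonneg le_rfl, neg_zero, cone_of_nonpos le_rfl, T.L_zero, S.α_zero, mul_one]

lemma norm_sq_of (f : A →ₚ[ℂ] ℂ) (g : Γ) (v : A) :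
    ((‖of T f g v‖ ^ 2 : ℝ) : ℂ) = form T f g v v := by
  rw [← inner_of, inner_self_eq_norm_sq_to_K]
  simp

/-- The operator between two summands of the regular space given by a linear map of `A`. -/
def pieceMap (f : A →ₚ[ℂ] ℂ) (g h : Γ) (φ : A →ₗ[ℂ] A) {C : ℝ} (hC : 0 ≤ C)
    (hφ : ∀ v, form T f h (φ v) (φ v) ≤ (C ^ 2 : ℝ) * form T f g v v) :
    HilbertPiece T f g →L[ℂ] HilbertPiece T f h :=
  (LinearMap.mkContinuous ((of T f h).toLinearMap ∘ₗ φ ∘ₗ (of T f g).symm.toLinearMap) C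
    fun v => by
      rw [← sq_le_sq₀ (norm_nonneg _) (by positivity), mul_pow, ← Complex.real_le_real,
        Complex.ofReal_mul]
      exact ((norm_sq_of (T := T) f h (φ v)).trans_le (hφ v)).trans_eq
        (congrArg _ (norm_sq_of (T := T) f g v).symm)).completion

lemma pieceMap_of (f : A →ₚ[ℂ] ℂ) (g h : Γ) (φ : A →ₗ[ℂ] A) {C : ℝ} (hC : 0 ≤ C)
    (hφ : ∀ v, form T f h (φ v) (φ v) ≤ (C ^ 2 : ℝ) * form T f g v v) (v : A) :
    pieceMap f g h φ hC hφ ((of T f g v : PreH T f g) : HilbertPiece T f g) =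
      ((of T f h (φ v) : PreH T f h) : HilbertPiece T f h) :=
  ContinuousLinearMap.completion_apply_coe _ _

lemma norm_pieceMap_le (f : A →ₚ[ℂ] ℂ) (g h : Γ) (φ : A →ₗ[ℂ] A) {C : ℝ} (hC : 0 ≤ C)
    (hφ : ∀ v, form T f h (φ v) (φ v) ≤ (C ^ 2 : ℝ) * form T f g v v) :
    ‖pieceMap f g h φ hC hφ‖ ≤ C := by
  refine ContinuousLinearMap.opNorm_le_bound _ hC fun ξ => ?_
  induction ξ using UniformSpace.Completion.induction_on with
  | hp => exact isClosed_le (by fun_prop) (by fun_prop)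
  | ih v =>
    rw [pieceMap, ContinuousLinearMap.completion_apply_coe, UniformSpace.Completion.norm_coe,
      UniformSpace.Completion.norm_coe]
    exact ContinuousLinearMap.le_of_opNorm_le _ (LinearMap.mkContinuous_norm_le _ hC _) v

/-- The operator on the regular space with given restrictions to the summands. -/
def regularMap {σ : Γ → Γ} (hσ : Function.Injective σ) (φ : Γ → A →ₗ[ℂ] A) {C : ℝ} (hC : 0 ≤ C)
    (hφ : ∀ (f : A →ₚ[ℂ] ℂ) g v,
      form T f g (φ g v) (φ g v) ≤ (C ^ 2 : ℝ) * form T f (σ g) v v) :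
    RegularSpace T →L[ℂ] RegularSpace T :=
  lpMap (σ := id) (fun f => lpMap (fun g => pieceMap f (σ g) g (φ g) hC (hφ f g)) hσ
    (fun g => norm_pieceMap_le f (σ g) g (φ g) hC (hφ f g)) hC) Function.injective_id
    (fun _ => norm_lpMap_le _ _ _ _) hC

lemma regularMap_vec {σ : Γ → Γ} (hσ : Function.Injective σ) (φ : Γ → A →ₗ[ℂ] A) {C : ℝ}
    (hC : 0 ≤ C) (hφ : ∀ (f : A →ₚ[ℂ] ℂ) g v,
      form T f g (φ g v) (φ g v) ≤ (C ^ 2 : ℝ) * form T f (σ g) v v)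
    (f : A →ₚ[ℂ] ℂ) (g : Γ) (v : A) :
    regularMap hσ φ hC hφ (vec T f (σ g) v) = vec T f g (φ g v) := by
  classical
  unfold vec
  refine (lpMap_single (σ := id) _ _ _ _ f _).trans ?_
  rw [lpMap_single, pieceMap_of]

/-- The span of the vectors `vec T f g v` is dense: the summands span a dense subspace of each
Hilbert sum, and `A` is dense in each summand. -/
lemma regular_clm_ext {E : Type*} [NormedAddCommGroup E] [NormedSpace ℂ E]
    {W W' : RegularSpace T →L[ℂ] E} (h : ∀ f g v, W (vec T f g v) = W' (vec T f g v)) :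
    W = W' := by
  classical
  refine lp.ext_continuousLinearMap (by simp) fun f => ?_
  refine lp.ext_continuousLinearMap (by simp) fun g => ?_
  ext ξ
  induction ξ using UniformSpace.Completion.induction_on with
  | hp => exact isClosed_eq (by fun_prop) (by fun_prop)
  | ih v =>
    have := h f g ((of T f g).symm v)
    unfold vec at this
    convert! this

lemma inner_vec (f : A →ₚ[ℂ] ℂ) (g : Γ) (u v : A) :
    inner ℂ (vec T f g u) (vec T f g v) = form T f g u v := by
  classical
  rw [vec, lp.inner_single_left, vec, lp.single_apply_self, lp.inner_single_left,
    lp.single_apply_self, UniformSpace.Completion.inner_coe, inner_of]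

lemma inner_vec_of_ne (f f' : A →ₚ[ℂ] ℂ) {g h : Γ} (hgh : g ≠ h) (u v : A) :
    inner ℂ (vec T f g u) (vec T f' h v) = 0 := by
  classical
  rw [vec, lp.inner_single_left, vec]
  by_cases hf : f = f'
  · subst hf
    rw [lp.single_apply_self, lp.inner_single_left, lp.single_apply_ne _ _ _ hgh, inner_zero_right]
  · rw [lp.single_apply_ne _ _ _ hf, inner_zero_right]

lemma inner_vec_of_ne' {f f' : A →ₚ[ℂ] ℂ} (hf : f ≠ f') (g h : Γ) (u v : A) :
    inner ℂ (vec T f g u) (vec T f' h v) = 0 := by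
  classical
  rw [vec, lp.inner_single_left, vec, lp.single_apply_ne _ _ _ hf, inner_zero_right]

lemma regular_ext {ξ η : RegularSpace T}
    (h : ∀ f g v, inner ℂ (vec T f g v) ξ = inner ℂ (vec T f g v) η) : ξ = η := by
  -- A vector is determined by the bounded functional it represents, to which density applies.
  have : innerSL ℂ ξ = innerSL ℂ η := regular_clm_ext fun f g v => by
    rw [innerSL_apply_apply, innerSL_apply_apply, ← inner_conj_symm, h, inner_conj_symm]
  exact (innerSL_inj (𝕜 := ℂ)).1 this

/-- Elements of `A` that differ by a null vector of the semi-inner product have the same class. This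
is what allows the projections `α_y(1)` to be inserted or dropped below. -/
lemma vec_congr {f : A →ₚ[ℂ] ℂ} {g : Γ} {u v : A} (h : ∀ w, form T f g w u = form T f g w v) :
    vec T f g u = vec T f g v := by
  refine regular_ext fun f' g' w => ?_
  by_cases hf : f' = f
  · subst hf
    by_cases hg : g' = g
    · subst hg
      rw [inner_vec, inner_vec, h]
    · rw [inner_vec_of_ne _ _ hg, inner_vec_of_ne _ _ hg]
  · rw [inner_vec_of_ne' hf, inner_vec_of_ne' hf]

/-- The form sees `u` only through `L_g(w^* u) = L_g(w^* u α_g(1))`. -/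
lemma vec_congr_of_nonneg {f : A →ₚ[ℂ] ℂ} {g : Γ} (hg : 0 ≤ g) {u v : A}
    (h : u * S.α (cone g) 1 = v * S.α (cone g) 1) : vec T f g u = vec T f g v :=
  vec_congr fun w => by
    rw [form_of_nonneg hg, form_of_nonneg hg, ← T.L_mul_one, ← T.L_mul_one _ (_ * v), mul_assoc,
      mul_assoc, h]

lemma vec_congr_of_nonpos {f : A →ₚ[ℂ] ℂ} {g : Γ} (hg : g ≤ 0) {u v : A}
    (h : S.α (cone (-g)) 1 * u = S.α (cone (-g)) 1 * v) : vec T f g u = vec T f g v :=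
  vec_congr fun w => by
    rw [form_of_nonpos hg, form_of_nonpos hg, mul_assoc, mul_assoc, h]

/-- If `φ` and `ψ` are adjoint to each other for the semi-inner products, then so are the operators.
Surjectivity of `σ` ensures that every summand is the source of one of the given formulas for `W`.
-/
lemma star_apply_vec {σ : Γ → Γ} (hσ : Function.Bijective σ)
    {W : RegularSpace T →L[ℂ] RegularSpace T} {φ ψ : Γ → A → A}
    (hW : ∀ f g v, W (vec T f (σ g) v) = vec T f g (φ g v))
    (h : ∀ (f : A →ₚ[ℂ] ℂ) g u v, form T f g (φ g u) v = form T f (σ g) u (ψ g v))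
    (f : A →ₚ[ℂ] ℂ) (g : Γ) (v : A) : star W (vec T f g v) = vec T f (σ g) (ψ g v) := by
  refine regular_ext fun f' g' u => ?_
  obtain ⟨k, rfl⟩ := hσ.2 g'
  rw [ContinuousLinearMap.star_eq_adjoint, ContinuousLinearMap.adjoint_inner_right, hW]
  by_cases hf : f' = f
  · subst hf
    by_cases hg : k = g
    · subst hg
      rw [inner_vec, inner_vec, h]
    · rw [inner_vec_of_ne _ _ hg, inner_vec_of_ne _ _ (hσ.1.ne hg)]
  · rw [inner_vec_of_ne' hf, inner_vec_of_ne' hf]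

lemma DynamicalSystem.star_α_one (S : DynamicalSystem A Γ) (x : Cone Γ) :
    star (S.α x 1) = S.α x 1 := by rw [← map_star, star_one]

lemma α_one_mul_α (S : DynamicalSystem A Γ) (x : Cone Γ) (a : A) :
    S.α x 1 * S.α x a = S.α x a := by rw [← map_mul, one_mul]

lemma α_mul_α_one (S : DynamicalSystem A Γ) (x : Cone Γ) (a : A) :
    S.α x a * S.α x 1 = S.α x a := by rw [← map_mul, mul_one]

lemma α_one_mul_α_of_le (S : DynamicalSystem A Γ) {g h : Γ} (hg : 0 ≤ g) (hgh : g ≤ h) (a : A) :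
    S.α (cone g) 1 * S.α (cone h) a = S.α (cone h) a := by
  rw [S.α_cone_add hg (sub_nonneg.2 hgh) (by abel : h = g + (h - g)), α_one_mul_α]

lemma α_mul_α_one_of_le (S : DynamicalSystem A Γ) {g h : Γ} (hg : 0 ≤ g) (hgh : g ≤ h) (a : A) :
    S.α (cone h) a * S.α (cone g) 1 = S.α (cone h) a := by
  rw [S.α_cone_add hg (sub_nonneg.2 hgh) (by abel : h = g + (h - g)), α_mul_α_one]

/-- `w^* c^* c w ≤ ‖c‖² w^* w`, and `f ∘ L_x` is positive. -/
lemma functional_L_mul_le (T : CompleteTransferAction S) (f : A →ₚ[ℂ] ℂ) (x : Cone Γ) {C : ℝ}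
    {c : A} (hc : ‖c‖ ≤ C) (w : A) :
    f (T.L x (star (c * w) * (c * w))) ≤ (C ^ 2 : ℝ) * f (T.L x (star w * w)) := by
  have h1 : star (c * w) * (c * w) ≤ (C ^ 2) • (star w * w) := by
    calc star (c * w) * (c * w) = star w * (star c * c) * w := by
          rw [star_mul]; simp only [mul_assoc]
      _ ≤ ‖star c * c‖ • (star w * w) := CStarAlgebra.star_left_conjugate_le_norm_smul
      _ ≤ (C ^ 2) • (star w * w) := by
          rw [CStarRing.norm_star_mul_self, ← sq]
          exact smul_le_smul_of_nonneg_right (pow_le_pow_left₀ (norm_nonneg _) hc 2)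
            (star_mul_self_nonneg w)
  have h2 := f.map_nonneg (T.nonneg x _ (sub_nonneg.2 h1))
  rw [← Complex.coe_smul, map_sub, map_smul, map_sub, map_smul, sub_nonneg, smul_eq_mul] at h2
  exact h2

lemma functional_mul_le (T : CompleteTransferAction S) (f : A →ₚ[ℂ] ℂ) {C : ℝ} {c : A}
    (hc : ‖c‖ ≤ C) (w : A) :
    f (star (c * w) * (c * w)) ≤ (C ^ 2 : ℝ) * f (star w * w) := by
  simpa only [T.L_zero] using functional_L_mul_le T f 0 hc w

/-- In degree `g ≤ 0` the length of `v` is the GNS length of `α_{-g}(1) v`, because `α_{-g}(1)` is a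
projection. -/
lemma form_self_of_nonpos {g : Γ} (h : g ≤ 0) (f : A →ₚ[ℂ] ℂ) (v : A) :
    form T f g v v = f (star (S.α (cone (-g)) 1 * v) * (S.α (cone (-g)) 1 * v)) := by
  rw [form_of_nonpos h, star_mul, S.star_α_one, mul_assoc, mul_assoc, ← mul_assoc (S.α _ 1),
    α_one_mul_one]

/-! ### The representation `π` on the regular space. -/

section Pi

/-- The action of `a ∈ A` on the summand with index `g`, as a linear map of `A`. -/
def piFun (S : DynamicalSystem A Γ) (a : A) (g : Γ) : A →ₗ[ℂ] A :=
  LinearMap.mulLeft ℂ (if 0 ≤ g then a else S.α (cone (-g)) a)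

lemma piFun_of_nonneg {g : Γ} (hg : 0 ≤ g) (a v : A) : piFun S a g v = a * v := by
  rw [piFun, if_pos hg, LinearMap.mulLeft_apply]

lemma piFun_of_nonpos {g : Γ} (hg : g ≤ 0) (a v : A) :
    piFun S a g v = S.α (cone (-g)) a * v := by
  rcases hg.lt_or_eq with h | rfl
  · rw [piFun, if_neg h.not_ge, LinearMap.mulLeft_apply]
  · rw [piFun_of_nonneg le_rfl, neg_zero, cone_of_nonpos le_rfl, S.α_zero]

lemma form_piFun_le (a : A) (f : A →ₚ[ℂ] ℂ) (g : Γ) (v : A) :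
    form T f g (piFun S a g v) (piFun S a g v) ≤ (‖a‖ ^ 2 : ℝ) * form T f g v v := by
  rcases le_total 0 g with hg | hg
  · rw [form_of_nonneg hg, form_of_nonneg hg, piFun_of_nonneg hg]
    exact functional_L_mul_le T f _ le_rfl v
  · rw [form_self_of_nonpos hg, form_self_of_nonpos hg, piFun_of_nonpos hg,
      ← mul_assoc (S.α _ 1) (S.α _ a), α_one_mul_α]
    -- Inserting the projection turns `α_{-g}(a) v` into `α_{-g}(a)` applied to `α_{-g}(1) v`, whose
    -- GNS length is the length of `v` in degree `g`.
    conv_lhs => rw [← α_mul_α_one, mul_assoc]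
    exact functional_mul_le T f (S.α_norm_le _ _) _

variable (T) in
/-- The operator `π(a)` of the regular representation. -/
def piOp (a : A) : RegularSpace T →L[ℂ] RegularSpace T :=
  regularMap (σ := id) Function.injective_id (piFun S a) (norm_nonneg a) (form_piFun_le a)

lemma piOp_vec (a : A) (f : A →ₚ[ℂ] ℂ) (g : Γ) (v : A) :
    piOp T a (vec T f g v) = vec T f g (piFun S a g v) :=
  regularMap_vec (σ := id) Function.injective_id _ _ _ f g v

lemma vec_add (f : A →ₚ[ℂ] ℂ) (g : Γ) (u v : A) :
    vec T f g (u + v) = vec T f g u + vec T f g v := by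
  simp only [vec, map_add, UniformSpace.Completion.coe_add, lp.single_add]

lemma vec_smul (f : A →ₚ[ℂ] ℂ) (g : Γ) (c : ℂ) (v : A) :
    vec T f g (c • v) = c • vec T f g v := by
  simp only [vec, map_smul, UniformSpace.Completion.coe_smul, lp.single_smul]

lemma piOp_one : piOp T 1 = 1 := by
  refine regular_clm_ext fun f g v => ?_
  rw [piOp_vec]
  rcases le_total 0 g with hg | hg
  · rw [piFun_of_nonneg hg, one_mul]; rfl
  · rw [piFun_of_nonpos hg]
    -- `v` and `α_{-g}(1) v` have the same class, so `π` is unital although `α` need not be.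
    exact vec_congr_of_nonpos hg (by rw [← mul_assoc, α_one_mul_one])

variable (T) in
/-- The representation `π` of `A` on the regular space. -/
def piRep : A →⋆ₐ[ℂ] (RegularSpace T →L[ℂ] RegularSpace T) where
  toFun := piOp T
  map_one' := piOp_one
  map_mul' a b := regular_clm_ext fun f g v => by
    rw [mul_apply_eq_comp, piOp_vec, piOp_vec, piOp_vec]
    rcases le_total 0 g with hg | hg
    · simp only [piFun_of_nonneg hg, mul_assoc]
    · simp only [piFun_of_nonpos hg, mul_assoc, map_mul]
  map_zero' := regular_clm_ext fun f g v => by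
    rw [piOp_vec, zero_apply, piFun, map_zero, ite_self,
      LinearMap.mulLeft_apply, zero_mul, ← zero_smul ℂ (0 : A), vec_smul, zero_smul]
  map_add' a b := regular_clm_ext fun f g v => by
    rw [add_apply, piOp_vec, piOp_vec, piOp_vec, ← vec_add]
    rcases le_total 0 g with hg | hg
    · simp only [piFun_of_nonneg hg, add_mul]
    · simp only [piFun_of_nonpos hg, add_mul, map_add]
  commutes' c := regular_clm_ext fun f g v => by
    have h : piOp T (algebraMap ℂ A c) (vec T f g v) = c • piOp T 1 (vec T f g v) := by
      rw [piOp_vec, piOp_vec, ← vec_smul, Algebra.algebraMap_eq_smul_one]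
      rcases le_total 0 g with hg | hg
      · simp only [piFun_of_nonneg hg, smul_mul_assoc]
      · simp only [piFun_of_nonpos hg, smul_mul_assoc, map_smul]
    rw [h, piOp_one]; rfl
  map_star' a := regular_clm_ext fun f g v => by
    rw [star_apply_vec (σ := id) Function.bijective_id (φ := fun g v => piFun S a g v)
      (ψ := fun g v => piFun S (star a) g v) (fun f g v => piOp_vec a f g v), piOp_vec]
    · rfl
    · intro f g u v
      rcases le_total 0 g with hg | hg
      · simp only [piFun_of_nonneg hg, form_of_nonneg hg, id, star_mul, mul_assoc]
      · simp only [piFun_of_nonpos hg, form_of_nonpos hg, id, star_mul, map_star]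
        -- Both sides equal `f(u^* α_{-g}(a^*) v)`, as `α_{-g}(a^*)` absorbs `α_{-g}(1)` from either
        -- side.
        rw [← map_star, mul_assoc (star u), α_mul_α_one, mul_assoc, mul_assoc,
          ← mul_assoc (S.α _ 1), α_one_mul_α]

lemma piRep_vec (a : A) (f : A →ₚ[ℂ] ℂ) (g : Γ) (v : A) :
    piRep T a (vec T f g v) = vec T f g (piFun S a g v) := piOp_vec a f g v

lemma piRep_vec_of_nonneg {g : Γ} (hg : 0 ≤ g) (a : A) (f : A →ₚ[ℂ] ℂ) (v : A) :
    piRep T a (vec T f g v) = vec T f g (a * v) := by rw [piRep_vec, piFun_of_nonneg hg]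

lemma piRep_vec_of_nonpos {g : Γ} (hg : g ≤ 0) (a : A) (f : A →ₚ[ℂ] ℂ) (v : A) :
    piRep T a (vec T f g v) = vec T f g (S.α (cone (-g)) a * v) := by
  rw [piRep_vec, piFun_of_nonpos hg]

end Pi

/-! ### The operators `U_x`, their adjoints, and covariance. -/

section Shift

/-- The action of `U_x` from the summand with index `g - x` to the one with index `g`, as a linear
map of `A`. -/
def shiftFun (S : DynamicalSystem A Γ) (x : Cone Γ) (g : Γ) : A →ₗ[ℂ] A :=
  if (x : Γ) ≤ g then (S.α x : A →ₗ[ℂ] A)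
  else if 0 ≤ g then LinearMap.mulLeft ℂ (S.α x 1) ∘ₗ (S.α (cone g) : A →ₗ[ℂ] A)
  else LinearMap.mulLeft ℂ (S.α (cone (x - g)) 1)

lemma shiftFun_apply (x : Cone Γ) (g : Γ) (v : A) : shiftFun S x g v =
    if (x : Γ) ≤ g then S.α x v else if 0 ≤ g then S.α x 1 * S.α (cone g) v
      else S.α (cone (x - g)) 1 * v := by
  unfold shiftFun
  split_ifs <;> rfl

lemma shiftFun_of_le {x : Cone Γ} {g : Γ} (h : (x : Γ) ≤ g) (v : A) :
    shiftFun S x g v = S.α x v := by rw [shiftFun_apply, if_pos h]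

/-- Since `x = g + (x - g)`, the projection `α_x(1)` can be pulled inside `α_g`. In this form the
middle formula also holds at both end points `g = 0` and `g = x`. -/
lemma shiftFun_of_nonneg_of_le {x : Cone Γ} {g : Γ} (h : 0 ≤ g) (hx : g ≤ x) (v : A) :
    shiftFun S x g v = S.α (cone g) (S.α (cone (x - g)) 1 * v) := by
  have h1 (a : A) : S.α x a = S.α (cone g) (S.α (cone (x - g)) a) := by
    rw [← S.α_cone_add h (sub_nonneg.2 hx) (by abel : (x : Γ) = g + (x - g)), cone_coe]
  rcases hx.lt_or_eq with hx | hx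
  · rw [shiftFun_apply, if_neg hx.not_ge, if_pos h, map_mul, h1]
  · rw [shiftFun_of_le hx.ge, h1, hx, sub_self, cone_of_nonpos le_rfl, S.α_zero, S.α_zero, one_mul]

lemma shiftFun_of_nonpos {x : Cone Γ} {g : Γ} (h : g ≤ 0) (v : A) :
    shiftFun S x g v = S.α (cone (x - g)) 1 * v := by
  rcases h.lt_or_eq with h | rfl
  · rw [shiftFun_apply, if_neg (h.trans_le x.2).not_ge, if_neg h.not_ge]
  · rw [shiftFun_of_nonneg_of_le le_rfl x.2, cone_of_nonpos le_rfl, S.α_zero]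

/-- `L_x(1)` is a central projection, so `L_x(α_x(w^* w)) = w^* w L_x(1) = (L_x(1) w)^* (L_x(1) w)`.
This makes `U_x` a contraction. -/
lemma functional_mul_L_one_le (f : A →ₚ[ℂ] ℂ) (x y : Cone Γ) (w : A) :
    f (T.L y (T.L x (S.α x (star w * w)))) ≤ f (T.L y (star w * w)) := by
  have h1 : ‖T.L x 1‖ ≤ 1 := (T.norm_L_le x 1).trans (by
    nontriviality A
    exact CStarRing.norm_one.le)
  have h2 : T.L x (S.α x (star w * w)) = star (T.L x 1 * w) * (T.L x 1 * w) := by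
    have h3 : T.L x 1 * (T.L x 1 * w) = w * T.L x 1 := by
      rw [← mul_assoc, T.L_mul_L_one, T.comm_L_one]
    rw [star_mul, T.star_L_one, T.L_α, mul_assoc (star w) (T.L x 1), h3, mul_assoc]
  rw [h2]
  simpa using functional_L_mul_le T f y h1 w

lemma form_shiftFun_le (x : Cone Γ) (f : A →ₚ[ℂ] ℂ) (g : Γ) (v : A) :
    form T f g (shiftFun S x g v) (shiftFun S x g v) ≤ ((1 : ℝ) ^ 2 : ℝ) * form T f (g - x) v v := by
  rw [one_pow, Complex.ofReal_one, one_mul]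
  rcases le_total 0 g with hg | hg
  · rcases le_total (x : Γ) g with hx | hx
    · rw [shiftFun_of_le hx, form_of_nonneg hg, form_of_nonneg (sub_nonneg.2 hx), ← map_star,
        ← map_mul, T.L_cone_add x.2 (sub_nonneg.2 hx) (by abel : g = x + (g - x)), cone_coe]
      exact functional_mul_L_one_le f x _ v
    · rw [shiftFun_of_nonneg_of_le hg hx, form_of_nonneg hg, form_self_of_nonpos (sub_nonpos.2 hx),
        neg_sub, ← map_star, ← map_mul]
      simpa only [T.L_zero] using functional_mul_L_one_le (T := T) f (cone g) 0 _
  · have hx : g - x ≤ 0 := sub_nonpos.2 (hg.trans x.2)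
    rw [shiftFun_of_nonpos hg, form_self_of_nonpos hg, form_self_of_nonpos hx, neg_sub,
      ← mul_assoc (S.α (cone (-g)) 1),
      α_one_mul_α_of_le S (neg_nonneg.2 hg) (by have := x.2; grind : -g ≤ x - g)]

variable (T) in
/-- The operator `U_x` of the regular representation. -/
def shiftOp (x : Cone Γ) : RegularSpace T →L[ℂ] RegularSpace T :=
  regularMap (sub_left_injective (b := (x : Γ))) (shiftFun S x) zero_le_one (form_shiftFun_le x)

lemma shiftOp_vec (x : Cone Γ) (f : A →ₚ[ℂ] ℂ) (g : Γ) (v : A) :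
    shiftOp T x (vec T f (g - x) v) = vec T f g (shiftFun S x g v) :=
  regularMap_vec (sub_left_injective (b := (x : Γ))) _ _ _ f g v

/-- One formula covers the three ranges of `g`: the index of `L` is `x` for `x ≤ g`, `g` for `0 ≤ g
≤ x`, and `0` for `g ≤ 0`, where `L_0` is the identity. This makes the adjoint easier to compose
than `U_x` itself. -/
lemma star_shiftOp_vec (x : Cone Γ) (f : A →ₚ[ℂ] ℂ) (g : Γ) (v : A) :
    star (shiftOp T x) (vec T f g v) = vec T f (g - x) (T.L (cone (min (x : Γ) g)) v) := by
  have hσ : Function.Bijective fun g : Γ => g - x :=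
    ⟨sub_left_injective, fun g => ⟨g + x, add_sub_cancel_right _ _⟩⟩
  refine star_apply_vec hσ (φ := fun g v => shiftFun S x g v)
    (ψ := fun g v => T.L (cone (min (x : Γ) g)) v)
    (shiftOp_vec x) ?_ f g v
  intro f g u v
  rcases le_total 0 g with hg | hg
  · rcases le_total (x : Γ) g with hx | hx
    · rw [shiftFun_of_le hx, form_of_nonneg hg, form_of_nonneg (sub_nonneg.2 hx), ← map_star,
        T.L_cone_add x.2 (sub_nonneg.2 hx) (by abel : g = x + (g - x)), cone_coe, min_eq_left hx,
        cone_coe, T.transfer]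
    · rw [shiftFun_of_nonneg_of_le hg hx, form_of_nonneg hg, form_of_nonpos (sub_nonpos.2 hx),
        neg_sub, ← map_star, T.transfer, min_eq_right hx, star_mul, S.star_α_one]
  · have hx : g - x ≤ 0 := sub_nonpos.2 (hg.trans x.2)
    rw [shiftFun_of_nonpos hg, form_of_nonpos hg, form_of_nonpos hx, neg_sub, star_mul,
      S.star_α_one, mul_assoc (star u), α_mul_α_one_of_le S (neg_nonneg.2 hg) (by
        have := x.2; grind), cone_of_nonpos (min_le_of_right_le hg), T.L_zero]

lemma isRegular_piRep_shiftOp : IsRegular T (piRep T) (shiftOp T) where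
  π_apply a f g v := by
    rw [piRep_vec, piFun, LinearMap.mulLeft_apply]
    split_ifs <;> rfl
  U_apply x f g v := by rw [shiftOp_vec, shiftFun_apply]

lemma IsRegular.unique {π π' : A →⋆ₐ[ℂ] (RegularSpace T →L[ℂ] RegularSpace T)}
    {U U' : Cone Γ → (RegularSpace T →L[ℂ] RegularSpace T)} (h : IsRegular T π U)
    (h' : IsRegular T π' U') : π' = π ∧ U' = U := by
  refine ⟨StarAlgHom.ext fun a => regular_clm_ext fun f g v => ?_,
    funext fun x => regular_clm_ext fun f g v => ?_⟩
  · rw [h.π_apply, h'.π_apply]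
  · rw [← add_sub_cancel_right g (x : Γ), h.U_apply, h'.U_apply]

lemma star_shiftOp_add (x y : Cone Γ) :
    star (shiftOp T (x + y)) = star (shiftOp T y) * star (shiftOp T x) := by
  refine regular_clm_ext fun f g v => ?_
  have hx := x.2
  have hy := y.2
  have h : ((x + y : Cone Γ) : Γ) = x + y := rfl
  rw [mul_apply_eq_comp, star_shiftOp_vec, star_shiftOp_vec, star_shiftOp_vec,
    ← T.L_add, h, sub_sub]
  congr 3
  refine Subtype.ext ?_
  -- By `T.L_add` only the indices have to be compared, and this is an identity for positive parts
  -- in `Γ`.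
  change max (min (x + y : Γ) g) 0 = max (min (x : Γ) g) 0 + max (min (y : Γ) (g - x)) 0
  rcases le_total (x : Γ) g with hg | hg
  · rw [min_eq_left hg, max_eq_left hx, max_eq_left (le_min (add_nonneg hx hy) (hx.trans hg)),
      max_eq_left (le_min hy (sub_nonneg.2 hg)), ← min_add_add_left, add_sub_cancel]
  · rw [min_eq_right hg, min_eq_right (hg.trans (le_add_of_nonneg_right hy)),
      max_eq_right (min_le_of_right_le (sub_nonpos.2 hg)), add_zero]

lemma shiftOp_zero : shiftOp T 0 = 1 := by
  refine star_injective (regular_clm_ext fun f g v => ?_)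
  have h : ((0 : Cone Γ) : Γ) = 0 := rfl
  rw [star_shiftOp_vec, star_one, h, cone_of_nonpos (min_le_left _ _), T.L_zero, sub_zero]
  rfl

lemma shiftOp_conj (x : Cone Γ) (a : A) :
    shiftOp T x * piRep T a * star (shiftOp T x) = piRep T (S.α x a) := by
  refine regular_clm_ext fun f g v => ?_
  rw [mul_apply_eq_comp, mul_apply_eq_comp, star_shiftOp_vec]
  rcases le_total 0 g with hg | hg
  · rw [piRep_vec_of_nonneg hg]
    rcases le_total (x : Γ) g with hx | hx
    · rw [piRep_vec_of_nonneg (sub_nonneg.2 hx), shiftOp_vec, shiftFun_of_le hx, min_eq_left hx,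
        cone_coe, map_mul, T.complete, ← mul_assoc, ← mul_assoc, α_mul_α_one]
      -- A surplus factor `α_x(1)` on the right is invisible in degree `g`, as `α_x(1) α_g(1) =
      -- α_g(1)` for `x ≤ g`.
      have h := α_one_mul_α_of_le S x.2 hx 1
      rw [cone_coe] at h
      exact vec_congr_of_nonneg hg (by rw [mul_assoc, h])
    · rw [piRep_vec_of_nonpos (sub_nonpos.2 hx), shiftOp_vec, shiftFun_of_nonneg_of_le hg hx,
        min_eq_right hx, neg_sub, ← mul_assoc, α_one_mul_α, map_mul, T.complete,
        ← S.α_cone_add hg (sub_nonneg.2 hx) (by abel : (x : Γ) = g + (x - g)), cone_coe]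
      -- Here `α_x(a)` absorbs the left factor `α_g(1)`, and the right one is invisible in degree
      -- `g`.
      have h := α_mul_α_one_of_le S hg hx a
      rw [cone_coe] at h
      refine vec_congr_of_nonneg hg ?_
      rw [← mul_assoc, ← mul_assoc, h, mul_assoc, α_one_mul_one]
  · have hx : g - x ≤ 0 := sub_nonpos.2 (hg.trans x.2)
    rw [piRep_vec_of_nonpos hg, cone_of_nonpos (min_le_of_right_le hg), T.L_zero,
      piRep_vec_of_nonpos hx, shiftOp_vec, shiftFun_of_nonpos hg, neg_sub, ← mul_assoc, α_one_mul_α,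
      ← cone_coe x, ← S.α_cone_add (neg_nonneg.2 hg) x.2 (sub_eq_neg_add _ _), cone_coe]

lemma shiftOp_conj' (x : Cone Γ) (a : A) :
    star (shiftOp T x) * piRep T a * shiftOp T x = piRep T (T.L x a) := by
  refine regular_clm_ext fun f h v => ?_
  -- The formula for `U_x` is indexed by the degree of its target.
  obtain ⟨g, rfl⟩ : ∃ g, h = g - x := ⟨h + x, (add_sub_cancel_right _ _).symm⟩
  rw [mul_apply_eq_comp, mul_apply_eq_comp, shiftOp_vec]
  rcases le_total 0 g with hg | hg
  · rw [piRep_vec_of_nonneg hg, star_shiftOp_vec]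
    rcases le_total (x : Γ) g with hx | hx
    · rw [piRep_vec_of_nonneg (sub_nonneg.2 hx), shiftFun_of_le hx, min_eq_left hx, cone_coe,
        T.transfer']
    · have hx' := sub_nonpos.2 hx
      rw [piRep_vec_of_nonpos hx', shiftFun_of_nonneg_of_le hg hx, min_eq_right hx, T.transfer']
      refine vec_congr_of_nonpos hx' ?_
      rw [neg_sub, ← cone_coe x, T.L_cone_add hg (sub_nonneg.2 hx) (by abel : (x : Γ) = g + (x - g)),
        cone_coe, T.complete]
      simp only [mul_assoc]
      rw [← mul_assoc (S.α _ 1) (S.α _ 1), α_one_mul_one]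
  · have hx : g - x ≤ 0 := sub_nonpos.2 (hg.trans x.2)
    rw [piRep_vec_of_nonpos hg, star_shiftOp_vec, cone_of_nonpos (min_le_of_right_le hg), T.L_zero,
      piRep_vec_of_nonpos hx, shiftFun_of_nonpos hg]
    refine vec_congr_of_nonpos hx ?_
    rw [neg_sub, S.α_cone_add (neg_nonneg.2 hg) x.2 (sub_eq_neg_add _ _), cone_coe,
      S.α_cone_add (neg_nonneg.2 hg) x.2 (sub_eq_neg_add _ _), cone_coe, T.complete]
    have h : S.α (cone (-g)) (S.α x 1) * S.α (cone (-g)) (S.α x 1) = S.α (cone (-g)) (S.α x 1) := by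
      rw [← map_mul, α_one_mul_one]
    simp only [map_mul, ← mul_assoc, h]

lemma isCovariant_piRep_shiftOp : IsCovariant T (piRep T) (shiftOp T) where
  U_zero := shiftOp_zero
  U_add x y := star_injective (by rw [star_shiftOp_add, star_mul])
  conj := shiftOp_conj
  conj' := shiftOp_conj'

end Shift

end CrossedProduct

namespace CrossedProduct

universe u v

/-! ### Positive functionals that attain the norm. -/

section States

variable {A : Type u} [CStarAlgebra A] [PartialOrder A] [StarOrderedRing A]

/-- From `1 + b ≤ ‖1 + b‖ · 1` one gets `b ≤ (‖1 + b‖ - 1) · 1`, and the order bounds the norm of `b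
≥ 0`. -/
lemma one_add_norm_le_norm_one_add [Nontrivial A] {b : A} (hb : 0 ≤ b) : 1 + ‖b‖ ≤ ‖1 + b‖ := by
  have h1 : (1 : ℝ) ≤ ‖1 + b‖ := by
    rw [← CStarRing.norm_one (E := A)]
    exact CStarAlgebra.norm_le_norm_of_nonneg_of_le zero_le_one (le_add_of_nonneg_right hb)
  have h2 : 1 + b ≤ algebraMap ℝ A ‖1 + b‖ :=
    (IsSelfAdjoint.of_nonneg (add_nonneg zero_le_one hb)).le_algebraMap_norm_self
  have h3 : b ≤ algebraMap ℝ A (‖1 + b‖ - 1) := by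
    rw [map_sub, map_one]
    exact le_sub_iff_add_le'.2 h2
  have h4 := (CStarAlgebra.norm_le_iff_le_algebraMap b (sub_nonneg.2 h1) hb).2 h3
  linarith

lemma norm_norm_sub_le {c : A} (hc : 0 ≤ c) : ‖algebraMap ℝ A ‖c‖ - c‖ ≤ ‖c‖ := by
  refine (CStarAlgebra.norm_le_iff_le_algebraMap _ (norm_nonneg c) ?_).2 (sub_le_self _ hc)
  exact sub_nonneg.2 (IsSelfAdjoint.of_nonneg hc).le_algebraMap_norm_self

/-- The hermitian part of a linear functional. -/
def hermitianPart (g : StrongDual ℂ A) : A →ₗ[ℂ] ℂ where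
  toFun c := (2 : ℂ)⁻¹ * (g c + star (g (star c)))
  map_add' c d := by simp only [map_add, star_add]; ring
  map_smul' z c := by
    simp only [map_smul, star_smul, smul_eq_mul, star_mul', star_star, RingHom.id_apply]; ring

lemma norm_hermitianPart_le {g : StrongDual ℂ A} (hg : ‖g‖ ≤ 1) (c : A) :
    ‖hermitianPart g c‖ ≤ ‖c‖ := by
  have h1 (c : A) : ‖g c‖ ≤ ‖c‖ := by simpa using g.le_of_opNorm_le hg c
  change ‖(2 : ℂ)⁻¹ * (g c + star (g (star c)))‖ ≤ _
  have h2 := norm_add_le (g c) (star (g (star c)))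
  have h3 := h1 (star c)
  rw [norm_star] at h2 h3
  rw [norm_mul, norm_inv, Complex.norm_ofNat]
  linarith [h1 c]

lemma hermitianPart_of_real {g : StrongDual ℂ A} {c : A} (hc : IsSelfAdjoint c) {r : ℝ}
    (h : g c = r) : hermitianPart g c = r := by
  change (2 : ℂ)⁻¹ * (g c + star (g (star c))) = _
  rw [hc.star_eq, h, Complex.star_def, Complex.conj_ofReal]
  ring

/-- The hermitian part is real on self-adjoint elements, so only the sign of its real part matters.
It sends `‖c‖ · 1` to `‖c‖` and does not increase norms, and `‖c‖ - c` has norm at most `‖c‖`; hence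
the value at `c` cannot be negative. -/
lemma hermitianPart_nonneg {g : StrongDual ℂ A} (hg : ‖g‖ ≤ 1) (h1 : g 1 = 1) (c : A)
    (hc : 0 ≤ c) : 0 ≤ hermitianPart g c := by
  have him : (hermitianPart g c).im = 0 := by
    change ((2 : ℂ)⁻¹ * (g c + star (g (star c)))).im = 0
    rw [(IsSelfAdjoint.of_nonneg hc).star_eq]
    simp
  have hr := (Complex.re_le_norm _).trans
    ((norm_hermitianPart_le hg (algebraMap ℝ A ‖c‖ - c)).trans (norm_norm_sub_le hc))
  have h2 : hermitianPart g (algebraMap ℝ A ‖c‖) = (‖c‖ : ℂ) := by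
    refine hermitianPart_of_real (IsSelfAdjoint.algebraMap A (IsSelfAdjoint.all _)) ?_
    rw [Algebra.algebraMap_eq_smul_one, ← Complex.coe_smul, map_smul, h1, smul_eq_mul, mul_one]
  rw [map_sub, h2, Complex.sub_re, Complex.ofReal_re] at hr
  exact Complex.nonneg_iff.2 ⟨by linarith, him.symm⟩

/-- Every `a` has its norm attained in the GNS representation of some state. -/
lemma exists_positive_functional (a : A) :
    ∃ f : A →ₚ[ℂ] ℂ, ‖f 1‖ ≤ 1 ∧ f (star a * a) = (‖a‖ ^ 2 : ℝ) := by
  rcases subsingleton_or_nontrivial A with hA | hA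
  · refine ⟨0, by simp, ?_⟩
    rw [Subsingleton.elim a 0]
    simp
  set b := star a * a
  have hb : 0 ≤ b := star_mul_self_nonneg a
  -- A functional norming `1 + b` does two things at once: `g(1)` and `g(b)` have real parts at most
  -- `1` and `‖b‖`, and these add up to at least `1 + ‖b‖`. So `g(1) = 1` and `g(b) = ‖b‖`.
  obtain ⟨g, hg1, hg2⟩ := exists_dual_vector'' ℂ (1 + b)
  have hle (c : A) : ‖g c‖ ≤ ‖c‖ := by simpa using g.le_of_opNorm_le hg1 c
  have hre (c : A) : (g c).re ≤ ‖c‖ := (Complex.re_le_norm _).trans (hle c)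
  have hsum : 1 + ‖b‖ ≤ (g 1).re + (g b).re := by
    refine (one_add_norm_le_norm_one_add hb).trans_eq ?_
    have := congrArg Complex.re hg2
    rw [map_add, Complex.add_re] at this
    exact this.symm
  have h1 := hre 1
  rw [CStarRing.norm_one] at h1
  have eq_of {c : A} (h : ‖c‖ ≤ (g c).re) : g c = (‖c‖ : ℂ) := by
    have h2 : (g c).re = ‖g c‖ := le_antisymm (Complex.re_le_norm _) ((hle c).trans h)
    have h3 : (g c).re = ‖c‖ := le_antisymm (hre c) h
    rw [← h3]
    exact Complex.ext rfl (Complex.re_eq_norm.1 h2).2.symm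
  have hg1' : g 1 = 1 := by
    rw [eq_of (c := 1) (by rw [CStarRing.norm_one]; linarith [hre b]), CStarRing.norm_one,
      Complex.ofReal_one]
  have hgb : g b = (‖b‖ : ℂ) := eq_of (by linarith)
  refine ⟨PositiveLinearMap.mk₀ (hermitianPart g) (hermitianPart_nonneg hg1 hg1'), ?_, ?_⟩
  · exact (norm_hermitianPart_le hg1 1).trans CStarRing.norm_one.le
  · refine (hermitianPart_of_real (IsSelfAdjoint.star_mul_self a) hgb).trans ?_
    rw [CStarRing.norm_star_mul_self, sq]

end States

/-! ### The representation of `l₁(Γ, α, A)` induced by a covariant representation. -/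

section Induced

variable {A : Type u} [CStarAlgebra A] {Γ : Type v} [AddCommGroup Γ] [LinearOrder Γ]
  [IsOrderedAddMonoid Γ] [PartialOrder A] [StarOrderedRing A]
  {S : DynamicalSystem A Γ} {T : CompleteTransferAction S}
  {H : Type*} [NormedAddCommGroup H] [InnerProductSpace ℂ H] [CompleteSpace H]
  {π : A →⋆ₐ[ℂ] (H →L[ℂ] H)} {U : Cone Γ → (H →L[ℂ] H)}

/-- The operator that a covariant representation assigns to `a δ_g`. -/
def inducedOp (π : A →⋆ₐ[ℂ] (H →L[ℂ] H)) (U : Cone Γ → (H →L[ℂ] H)) (g : Γ) (a : A) :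
    H →L[ℂ] H :=
  if 0 ≤ g then π a * U (cone g) else star (U (cone (-g))) * π a

lemma inducedOp_of_nonneg {g : Γ} (h : 0 ≤ g) (a : A) : inducedOp π U g a = π a * U (cone g) :=
  if_pos h

lemma inducedOp_add (g : Γ) (a b : A) :
    inducedOp π U g (a + b) = inducedOp π U g a + inducedOp π U g b := by
  unfold inducedOp
  split_ifs <;> simp [add_mul, mul_add]

lemma inducedOp_smul (g : Γ) (c : ℂ) (a : A) :
    inducedOp π U g (c • a) = c • inducedOp π U g a := by
  unfold inducedOp
  split_ifs <;> simp

namespace IsCovariant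

variable (h : IsCovariant T π U)
include h

lemma inducedOp_of_nonpos {g : Γ} (hg : g ≤ 0) (a : A) :
    inducedOp π U g a = star (U (cone (-g))) * π a := by
  rcases hg.lt_or_eq with hg | rfl
  · exact if_neg hg.not_ge
  · rw [inducedOp_of_nonneg le_rfl, neg_zero, cone_of_nonpos le_rfl, h.U_zero, star_one, one_mul,
      mul_one]

lemma star_inducedOp (g : Γ) (a : A) :
    star (inducedOp π U g a) = inducedOp π U (-g) (star a) := by
  rcases le_total 0 g with hg | hg
  · rw [inducedOp_of_nonneg hg, h.inducedOp_of_nonpos (neg_nonpos.2 hg), neg_neg, star_mul,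
      map_star]
  · rw [inducedOp_of_nonneg (neg_nonneg.2 hg), h.inducedOp_of_nonpos hg, star_mul, star_star,
      map_star]

lemma U_mul_star (x : Cone Γ) : U x * star (U x) = π (S.α x 1) := by
  rw [← h.conj, map_one, mul_one]

lemma star_mul_U (x : Cone Γ) : star (U x) * U x = π (T.L x 1) := by
  rw [← h.conj', map_one, mul_one]

lemma norm_U_le (x : Cone Γ) : ‖U x‖ ≤ 1 := by
  have h1 : ‖U x‖ * ‖U x‖ ≤ 1 := by
    rw [← CStarRing.norm_self_mul_star, h.U_mul_star]
    refine (NonUnitalStarAlgHom.norm_apply_le π _).trans ((S.α_norm_le x 1).trans ?_)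
    rcases subsingleton_or_nontrivial A with hA | hA
    · rw [Subsingleton.elim (1 : A) 0, norm_zero]; exact zero_le_one
    · exact CStarRing.norm_one.le
  nlinarith [norm_nonneg (U x)]

lemma norm_inducedOp_le (g : Γ) (a : A) : ‖inducedOp π U g a‖ ≤ ‖a‖ := by
  have h1 : ‖π a‖ ≤ ‖a‖ := NonUnitalStarAlgHom.norm_apply_le π _
  have h2 := h.norm_U_le
  unfold inducedOp
  split_ifs
  · exact (norm_mul_le _ _).trans
      ((mul_le_of_le_one_right (norm_nonneg _) (h2 _)).trans h1)
  · refine (norm_mul_le _ _).trans ((mul_le_of_le_one_left (norm_nonneg _) ?_).trans h1)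
    rw [norm_star]; exact h2 _

/-- `U_x^* U_x = π(L_x(1))` is a projection, so `U_x π(L_x(1)) = U_x`. As `L_x(1)` is central, `U_x
π(a) = U_x π(a) U_x^* U_x`, and covariance applies to the first three factors. -/
lemma U_mul_π (x : Cone Γ) (a : A) : U x * π a = π (S.α x a) * U x := by
  have hp : π (T.L x 1) * π (T.L x 1) = π (T.L x 1) := by rw [← map_mul, T.L_mul_L_one]
  have h1 : U x * π (T.L x 1) = U x := by
    -- The `C^*`-identity reduces the claim to an identity for `U_x^* U_x`.
    have h2 : star (U x * π (T.L x 1) - U x) * (U x * π (T.L x 1) - U x) = 0 := by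
      rw [star_sub, star_mul, ← map_star, T.star_L_one, sub_mul, mul_sub, mul_sub, mul_assoc,
        ← mul_assoc (star (U x)), h.star_mul_U, hp, hp, mul_assoc, h.star_mul_U, hp, sub_self]
    exact sub_eq_zero.1 ((CStarRing.star_mul_self_eq_zero_iff _).1 h2)
  calc U x * π a = U x * π (T.L x 1) * π a := by rw [h1]
    _ = U x * π a * star (U x) * U x := by
      rw [mul_assoc, ← map_mul, T.comm_L_one, map_mul, ← h.star_mul_U]
      simp only [mul_assoc]
    _ = π (S.α x a) * U x := by rw [h.conj]

/-- For `k ≤ 0`, write `U_g = U_{g+k} U_{-k}`; the projection `U_{-k} U_{-k}^* = π(α_{-k}(1))` fixes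
`π(b)`, which is where the condition on the coefficient `b` enters. For `g ≤ 0`, write `U_k = U_{-g}
U_{g+k}` and use `U_{-g}^* π(ab) U_{-g} = π(L_{-g}(ab))`. If both are nonnegative, `U_g` moves past
`π(b)`. Degrees `g + k ≤ 0` follow by taking adjoints. -/
lemma inducedOp_mul_aux {g k : Γ} {a b : A} (hb : IsCoeff S k b) (hs : 0 ≤ g + k) :
    inducedOp π U g a * inducedOp π U k b = inducedOp π U (g + k) (mulCoeff T g k a b) := by
  rw [isCoeff_iff] at hb
  rw [inducedOp_of_nonneg hs]
  rcases le_total k 0 with hk | hk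
  · have hg : 0 ≤ g := by grind
    have h1 : cone g = cone (g + k) + cone (-k) := by
      rw [← cone_add hs (neg_nonneg.2 hk), add_neg_cancel_right]
    have h2 : U (cone (-k)) * (star (U (cone (-k))) * π b) = π b := by
      rw [← mul_assoc, h.U_mul_star, ← map_mul, hb.2]
    rw [mc1 T hs hk, inducedOp_of_nonneg hg, h.inducedOp_of_nonpos hk, map_mul,
      mul_assoc (π a) (π _), ← h.U_mul_π, h1, h.U_add]
    simp only [mul_assoc, h2]
  rcases le_total g 0 with hg | hg
  · rw [mc2 T hs hg, h.inducedOp_of_nonpos hg, inducedOp_of_nonneg hk]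
    have h1 : cone k = cone (-g) + cone (g + k) := by
      rw [← cone_add (neg_nonneg.2 hg) hs, neg_add_cancel_left]
    rw [h1, h.U_add, ← h.conj', map_mul]
    simp only [mul_assoc]
  · rw [mc3 T hg hk, inducedOp_of_nonneg hg, inducedOp_of_nonneg hk, cone_add hg hk, h.U_add,
      map_mul, mul_assoc (π a), ← mul_assoc (U _), h.U_mul_π]
    simp only [mul_assoc]

lemma inducedOp_mul {g k : Γ} {a b : A} (ha : IsCoeff S g a) (hb : IsCoeff S k b) :
    inducedOp π U g a * inducedOp π U k b = inducedOp π U (g + k) (mulCoeff T g k a b) := by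
  rcases le_total 0 (g + k) with hs | hs
  · exact h.inducedOp_mul_aux hb hs
  · rw [← star_inj, star_mul, h.star_inducedOp, h.star_inducedOp, h.star_inducedOp, star_mulCoeff,
      h.inducedOp_mul_aux ha.star (by grind), neg_add_rev]

lemma summable_norm_inducedOp (a : L1 T) : Summable fun g => ‖inducedOp π U g (a.coeff g)‖ :=
  a.hasSum_norm.summable.of_nonneg_of_le (fun _ => norm_nonneg _) fun _ => h.norm_inducedOp_le _ _

/-- The linear map of `l₁(Γ, α, A)` that is induced by a covariant representation. -/
def inducedCLM : L1 T →L[ℂ] (H →L[ℂ] H) :=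
  LinearMap.mkContinuous
    { toFun := fun a => ∑' g, inducedOp π U g (a.coeff g)
      map_add' := fun a b => by
        rw [← (h.summable_norm_inducedOp a).of_norm.tsum_add (h.summable_norm_inducedOp b).of_norm]
        exact tsum_congr fun g => inducedOp_add g _ _
      map_smul' := fun c a => by
        rw [RingHom.id_apply, ← (h.summable_norm_inducedOp a).of_norm.tsum_const_smul]
        exact tsum_congr fun g => inducedOp_smul g _ _ } 1 fun a => by
    rw [one_mul]
    exact tsum_of_norm_bounded a.hasSum_norm fun g => h.norm_inducedOp_le _ _

lemma hasSum_inducedCLM (a : L1 T) :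
    HasSum (fun g => inducedOp π U g (a.coeff g)) (h.inducedCLM a) :=
  (h.summable_norm_inducedOp a).of_norm.hasSum

lemma inducedCLM_single (g : Γ) (a : A) (ha : IsCoeff S g a) :
    h.inducedCLM (L1.single g a ha) = inducedOp π U g a := by
  refine (h.hasSum_inducedCLM _).unique ?_
  have h1 := hasSum_single (f := fun k => inducedOp π U k ((L1.single g a ha : L1 T).coeff k)) g
    fun k hk => by
      rw [L1.coeff_single, if_neg hk, ← zero_smul ℂ (0 : A), inducedOp_smul, zero_smul]
  rwa [L1.coeff_single, if_pos rfl] at h1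

/-- Both sides are continuous in each variable, so homogeneous elements suffice. -/
lemma inducedCLM_mul (a b : L1 T) :
    h.inducedCLM (a * b) = h.inducedCLM a * h.inducedCLM b := by
  have h1 (g : Γ) (a : A) (ha : IsCoeff S g a) (b : L1 T) :
      h.inducedCLM (L1.single g a ha * b) = h.inducedCLM (L1.single g a ha) * h.inducedCLM b :=
    congrArg (fun f : L1 T →L[ℂ] (H →L[ℂ] H) => f b) (L1.clm_ext
      (f := h.inducedCLM.comp (L1.mulCLM (L1.single g a ha : L1 T)))
      (f' := (ContinuousLinearMap.mul ℂ (H →L[ℂ] H) (h.inducedCLM (L1.single g a ha))).comp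
        h.inducedCLM)
      fun k b hb => by
        rw [ContinuousLinearMap.comp_apply, ContinuousLinearMap.comp_apply, L1.mulCLM_apply,
          ContinuousLinearMap.mul_apply', L1.single_mul_single, h.inducedCLM_single,
          h.inducedCLM_single, h.inducedCLM_single, h.inducedOp_mul ha hb])
  exact congrArg (fun f : L1 T →L[ℂ] (H →L[ℂ] H) => f a) (L1.clm_ext
    (f := h.inducedCLM.comp (L1.mulCLM.flip b))
    (f' := ((ContinuousLinearMap.mul ℂ (H →L[ℂ] H)).flip (h.inducedCLM b)).comp h.inducedCLM)
    fun g a ha => h1 g a ha b)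

/-- The representation of `l₁(Γ, α, A)` that is induced by a covariant representation. -/
def inducedRep : L1 T →⋆ₐ[ℂ] (H →L[ℂ] H) where
  __ := AlgHom.ofLinearMap h.inducedCLM.toLinearMap
    ((h.inducedCLM_single 0 1 L1.isCoeff_one).trans (by
      rw [inducedOp_of_nonneg le_rfl, cone_of_nonpos le_rfl, h.U_zero, map_one, mul_one]))
    h.inducedCLM_mul
  map_star' a := by
    refine (h.hasSum_inducedCLM (star a)).unique ?_
    rw [← (Equiv.neg Γ).hasSum_iff]
    have h1 : (fun g => inducedOp π U g ((star a).coeff g)) ∘ Equiv.neg Γ =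
        fun g => star (inducedOp π U g (a.coeff g)) := by
      funext g
      rw [h.star_inducedOp, Function.comp_apply, Equiv.neg_apply, L1.coeff_star, neg_neg]
    rw [h1]
    exact (h.hasSum_inducedCLM a).star

lemma hasSum_inducedRep (a : L1 T) :
    HasSum (fun g => inducedOp π U g (a.coeff g)) (h.inducedRep a) := h.hasSum_inducedCLM a

lemma inducedRep_single (g : Γ) (a : A) (ha : IsCoeff S g a) :
    h.inducedRep (L1.single g a ha) = inducedOp π U g a := h.inducedCLM_single g a ha

lemma continuous_inducedRep : Continuous h.inducedRep := h.inducedCLM.continuous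

end IsCovariant

end Induced

end CrossedProduct

/-! ### Extension of representations to the enveloping `C^*`-algebra. -/

namespace Enveloping

universe w

variable {R : Type w} [NormedRing R] [StarRing R] [NormedStarGroup R] [NormedAlgebra ℂ R]
  [StarModule ℂ R] [CompleteSpace R] {H : Type w} [NormedAddCommGroup H] [InnerProductSpace ℂ H]
  [CompleteSpace H]

namespace EnvelopingAlgebra

open UniformSpace

lemma norm_ι (a : R) : ‖ι R a‖ = envNorm R a := norm_coeHom R a

/-- The continuous linear map of the enveloping algebra given by a representation. -/
def liftCLM (ρ : R →⋆ₐ[ℂ] (H →L[ℂ] H)) : EnvelopingAlgebra R →L[ℂ] (H →L[ℂ] H) :=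
  ContinuousLinearMap.fromCompletion (LinearMap.mkContinuous (E := Pre R) (σ := RingHom.id ℂ)
    { toFun := fun a => ρ a, map_add' := map_add ρ, map_smul' := map_smul ρ } 1
    -- `H` lies in the universe of `R`, so `ρ` is among the representations over which the supremum
    -- is taken.
    fun a => by rw [one_mul]; exact norm_rep_le_envNorm ρ a)

lemma liftCLM_ι (ρ : R →⋆ₐ[ℂ] (H →L[ℂ] H)) (a : R) : liftCLM ρ (ι R a) = ρ a :=
  ContinuousLinearMap.fromCompletion_apply_coe (α := Pre R) _ a

/-- The representation of the enveloping algebra given by a representation of `R`. -/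
def lift (ρ : R →⋆ₐ[ℂ] (H →L[ℂ] H)) : EnvelopingAlgebra R →⋆ₐ[ℂ] (H →L[ℂ] H) where
  __ := AlgHom.ofLinearMap (liftCLM ρ).toLinearMap
    ((congrArg (liftCLM ρ) (map_one (ι R))).symm.trans ((liftCLM_ι ρ 1).trans (map_one ρ)))
    fun x y => by
      induction x, y using coeHom_ind₂ with
      | hp =>
        exact isClosed_eq ((liftCLM ρ).continuous.comp (continuous_fst.mul continuous_snd))
          (((liftCLM ρ).continuous.comp continuous_fst).mul
            ((liftCLM ρ).continuous.comp continuous_snd))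
      | h a b =>
        change liftCLM ρ (ι R a * ι R b) = liftCLM ρ (ι R a) * liftCLM ρ (ι R b)
        rw [← map_mul, liftCLM_ι, liftCLM_ι, liftCLM_ι, map_mul]
  map_star' x := by
    change liftCLM ρ (star x) = star (liftCLM ρ x)
    induction x using continuous_coeHom_ind with
    | hp =>
      exact isClosed_eq ((liftCLM ρ).continuous.comp (continuous_star' R))
        (continuous_star.comp (liftCLM ρ).continuous)
    | h a =>
      change liftCLM ρ (star (ι R a)) = star (liftCLM ρ (ι R a))
      rw [← map_star, liftCLM_ι, liftCLM_ι, map_star]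

lemma lift_ι (ρ : R →⋆ₐ[ℂ] (H →L[ℂ] H)) (a : R) : lift ρ (ι R a) = ρ a := liftCLM_ι ρ a

/-- `*`-homomorphisms between `C^*`-algebras are contractive, and the image of `ι` is dense. -/
lemma starAlgHom_ext {B : Type*} [CStarAlgebra B] {Φ Φ' : EnvelopingAlgebra R →⋆ₐ[ℂ] B}
    (h : ∀ a, Φ (ι R a) = Φ' (ι R a)) : Φ = Φ' :=
  StarAlgHom.ext fun x => by
    induction x using continuous_coeHom_ind with
    | hp =>
      have hc (Ψ : EnvelopingAlgebra R →⋆ₐ[ℂ] B) : Continuous Ψ :=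
        AddMonoidHomClass.continuous_of_bound Ψ 1 fun x => by
          rw [one_mul]; exact NonUnitalStarAlgHom.norm_apply_le Ψ x
      exact isClosed_eq (hc Φ) (hc Φ')
    | h a => exact h a

/-- The hypothesis says that the extension does not decrease norms on the dense image of `R`; by
continuity it does not decrease them anywhere. -/
lemma lift_injective {ρ : R →⋆ₐ[ℂ] (H →L[ℂ] H)} (h : ∀ a, envNorm R a ≤ ‖ρ a‖) :
    Function.Injective (lift ρ) := by
  have h1 (x : EnvelopingAlgebra R) : ‖x‖ ≤ ‖lift ρ x‖ := by
    induction x using continuous_coeHom_ind with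
    | hp => exact isClosed_le continuous_norm (continuous_norm.comp (liftCLM ρ).continuous)
    | h a =>
      change ‖ι R a‖ ≤ ‖lift ρ (ι R a)‖
      rw [norm_ι, lift_ι]
      exact h a
  refine (injective_iff_map_eq_zero _).2 fun x hx => ?_
  simpa [hx] using h1 x

end EnvelopingAlgebra

end Enveloping

/-! ### Removing a polynomial factor by taking powers. -/

/-- If `y < x` with `y > 0`, then `(x / y) ^ 2 ^ n` would be bounded by a polynomial in `2 ^ n`. For
`y = 0` the case `n = 0` is enough. -/
lemma le_of_forall_pow_two_pow_le {x y K : ℝ} (hy : 0 ≤ y) (s : ℕ)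
    (h : ∀ n : ℕ, x ^ 2 ^ n ≤ K * ((2 ^ n : ℕ) + 1 : ℝ) ^ s * y ^ 2 ^ n) : x ≤ y := by
  by_contra! hxy
  rcases hy.lt_or_eq with hy | rfl
  · have hr : 1 < x / y := (one_lt_div hy).2 hxy
    have h1 (n : ℕ) : 1 ≤ |K| * 2 ^ s * (((2 ^ n : ℕ) : ℝ) ^ s / (x / y) ^ 2 ^ n) := by
      have hm : (1 : ℝ) ≤ (2 ^ n : ℕ) := by exact_mod_cast Nat.one_le_two_pow
      have h2 : (x / y) ^ 2 ^ n ≤ |K| * ((2 : ℝ) ^ s * ((2 ^ n : ℕ) : ℝ) ^ s) := by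
        rw [div_pow, div_le_iff₀ (by positivity), ← mul_pow]
        refine (h n).trans ?_
        gcongr
        · exact le_abs_self K
        · linarith
      rw [mul_div_assoc', le_div_iff₀ (by positivity), one_mul, mul_assoc]
      exact h2
    have h2 : Filter.Tendsto (fun n : ℕ => |K| * 2 ^ s * (((2 ^ n : ℕ) : ℝ) ^ s / (x / y) ^ 2 ^ n))
        Filter.atTop (nhds (|K| * 2 ^ s * 0)) :=
      ((tendsto_pow_const_div_const_pow_of_one_lt s hr).comp
        (tendsto_pow_atTop_atTop_of_one_lt one_lt_two)).const_mul _
    have := ge_of_tendsto' h2 h1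
    linarith
  · have := h 0
    simp only [pow_zero, pow_one, mul_zero] at this
    linarith

namespace CrossedProduct

universe u v

variable {A : Type u} [CStarAlgebra A] {Γ : Type v} [AddCommGroup Γ] [LinearOrder Γ]
  [IsOrderedAddMonoid Γ] [PartialOrder A] [StarOrderedRing A]
  {S : DynamicalSystem A Γ} {T : CompleteTransferAction S}

open PreH

/-! ### Coefficients of `a a^*` and supports of powers. -/

namespace L1

lemma mulCoeff_star_self_nonneg (T : CompleteTransferAction S) (g : Γ) (a : A) :
    0 ≤ mulCoeff T g (-g) a (star a) := by
  rcases le_total 0 g with hg | hg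
  · rw [mc1 T (add_neg_cancel g).ge (neg_nonpos.2 hg), add_neg_cancel, cone_of_nonpos le_rfl,
      S.α_zero]
    exact mul_star_self_nonneg a
  · rw [mc2 T (add_neg_cancel g).ge hg]
    exact T.nonneg _ _ (mul_star_self_nonneg a)

/-- For `g ≤ 0` the product is `L_{-g}(a a^*)`. Since `a` lies in `α_{-g}(1) A`, the contraction
`α_{-g}` takes it back to `a a^*`, so no norm is lost. -/
lemma norm_sq_le_norm_mulCoeff_star_self (T : CompleteTransferAction S) {g : Γ} {a : A}
    (ha : IsCoeff S g a) : ‖a‖ ^ 2 ≤ ‖mulCoeff T g (-g) a (star a)‖ := by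
  rw [sq, ← CStarRing.norm_self_mul_star]
  rcases le_total 0 g with hg | hg
  · rw [mc1 T (add_neg_cancel g).ge (neg_nonpos.2 hg), add_neg_cancel, cone_of_nonpos le_rfl,
      S.α_zero]
  · rw [mc2 T (add_neg_cancel g).ge hg]
    have h1 := ((isCoeff_iff S g a).1 ha).2
    have h2 : S.α (cone (-g)) (T.L (cone (-g)) (a * star a)) = a * star a := by
      have h3 := congrArg star h1
      rw [star_mul, S.star_α_one] at h3
      rw [T.complete, ← mul_assoc, h1, mul_assoc, h3]
    exact (congrArg norm h2).symm.trans_le (S.α_norm_le _ _)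

/-- The zeroth coefficient of `a a^*` is the sum of the positive elements `(a_g δ_g)(a_g δ_g)^*`, so
it dominates each of them. -/
lemma norm_coeff_sq_le (a : L1 T) (g : Γ) : ‖a.coeff g‖ ^ 2 ≤ ‖(a * star a).coeff 0‖ := by
  have h1 := (summable_mulCoeff a (star a) 0).hasSum
  rw [← coeff_mul] at h1
  simp only [coeff_star, zero_sub, neg_neg] at h1
  exact (norm_sq_le_norm_mulCoeff_star_self T (a.isCoeff_coeff g)).trans
    (CStarAlgebra.norm_le_norm_of_nonneg_of_le (mulCoeff_star_self_nonneg T g _)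
      (le_hasSum h1 g fun x _ => mulCoeff_star_self_nonneg T x _))

lemma norm_le_card_mul {a : L1 T} {F : Finset Γ} (hF : ∀ g ∉ F, a.coeff g = 0) {C : ℝ}
    (hC : ∀ g, ‖a.coeff g‖ ≤ C) : ‖a‖ ≤ F.card * C := by
  rw [← a.hasSum_norm.tsum_eq, tsum_eq_sum (s := F) fun g hg => by rw [hF g hg, norm_zero],
    ← nsmul_eq_mul]
  exact Finset.sum_le_card_nsmul _ _ _ fun g _ => hC g

lemma exists_of_coeff_mul_ne_zero {a b : L1 T} {g : Γ} (h : (a * b).coeff g ≠ 0) :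
    ∃ x y, x + y = g ∧ a.coeff x ≠ 0 ∧ b.coeff y ≠ 0 := by
  by_contra! hn
  refine h ?_
  rw [coeff_mul]
  refine (tsum_congr fun x => ?_).trans tsum_zero
  by_cases hx : a.coeff x = 0
  · simpa [hx] using mulCoeff_smul_left T x (g - x) 0 0 (b.coeff (g - x))
  · rw [hn x (g - x) (add_sub_cancel _ _) hx]
    simpa using mulCoeff_smul_right T x (g - x) 0 (a.coeff x) 0

/-- A point of the support of `a ^ k` is a sum of `k` elements of `F`. As `Γ` is abelian, only the
multiplicity of each element matters, not the order. -/
lemma exists_of_coeff_pow_ne_zero {a : L1 T} {F : Finset Γ} (hF : ∀ g ∉ F, a.coeff g = 0) (k : ℕ)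
    {g : Γ} (h : (a ^ k).coeff g ≠ 0) :
    ∃ n : F → ℕ, (∀ s, n s ≤ k) ∧ ∑ s, n s • (s : Γ) = g := by
  induction k generalizing g with
  | zero =>
    refine ⟨0, fun _ => le_rfl, ?_⟩
    rw [pow_zero, one_def, coeff_single] at h
    have hg : g = 0 := by_contra fun hg => h (if_neg hg)
    simp [hg]
  | succ k ih =>
    rw [pow_succ] at h
    obtain ⟨x, y, rfl, hx, hy⟩ := exists_of_coeff_mul_ne_zero h
    obtain ⟨n, hn, rfl⟩ := ih hx
    have hyF : y ∈ F := by_contra fun hy' => hy (hF y hy')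
    classical
    refine ⟨n + Pi.single ⟨y, hyF⟩ 1, fun s => ?_, ?_⟩
    · refine add_le_add (hn s) ?_
      rw [Pi.single_apply]
      split_ifs <;> simp
    · simp only [Pi.add_apply, add_smul, Finset.sum_add_distrib, Pi.single_apply, ite_smul, one_smul,
        zero_smul, Finset.sum_ite_eq', Finset.mem_univ, if_true]

/-- Each multiplicity lies in `{0, …, k}`, so there are `(k + 1) ^ F.card` choices: polynomially
many in `k` for fixed `F`. -/
lemma exists_support_pow {a : L1 T} {F : Finset Γ} (hF : ∀ g ∉ F, a.coeff g = 0) (k : ℕ) :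
    ∃ F' : Finset Γ, F'.card ≤ (k + 1) ^ F.card ∧ ∀ g ∉ F', (a ^ k).coeff g = 0 := by
  classical
  refine ⟨(Fintype.piFinset fun _ : F => Finset.range (k + 1)).image
    fun n : F → ℕ => ∑ s : F, n s • (s : Γ), ?_, fun g hg => by_contra fun h => hg ?_⟩
  · refine Finset.card_image_le.trans ?_
    simp
  · obtain ⟨n, hn, rfl⟩ := exists_of_coeff_pow_ne_zero hF k h
    exact Finset.mem_image_of_mem _
      (Fintype.mem_piFinset.2 fun s => Finset.mem_range.2 (Nat.lt_succ_of_le (hn s)))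

lemma exists_support_mul_star {a : L1 T} {F : Finset Γ} (hF : ∀ g ∉ F, a.coeff g = 0) :
    ∃ F' : Finset Γ, ∀ g ∉ F', (a * star a).coeff g = 0 := by
  classical
  refine ⟨(F ×ˢ F).image fun p => p.1 - p.2, fun g hg => by_contra fun h => hg ?_⟩
  obtain ⟨x, y, rfl, hx, hy⟩ := exists_of_coeff_mul_ne_zero h
  rw [coeff_star] at hy
  refine Finset.mem_image.2 ⟨(x, -y), Finset.mem_product.2 ⟨?_, ?_⟩, by simp⟩
  · exact by_contra fun hx' => hx (hF x hx')
  · exact by_contra fun hy' => hy (by rw [hF _ hy', star_zero])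

end L1

/-! ### Domination of the enveloping norm. -/

section Faithful

open Enveloping EnvelopingAlgebra

/-- The constant is harmless, because it disappears when roots of order `2 ^ n` are taken. -/
lemma norm_ι_le (a : L1 T) : ‖ι (L1 T) a‖ ≤ Real.sqrt ‖(1 : L1 T)‖ * ‖a‖ := by
  refine (Real.le_sqrt_of_sq_le (norm_rep_sq_le (L1 T) (ι (L1 T)) a)).trans_eq ?_
  rw [mul_comm, Real.sqrt_mul (norm_nonneg _), Real.sqrt_sq (norm_nonneg _)]

variable {H : Type*} [NormedAddCommGroup H] [InnerProductSpace ℂ H] [CompleteSpace H]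
  {ρ : L1 T →⋆ₐ[ℂ] (H →L[ℂ] H)}

/-- A representation of `l₁(Γ, α, A)` that dominates the zeroth coefficient dominates every
coefficient. -/
lemma norm_coeff_le_of_norm_coeff_zero_le (h : ∀ a, ‖a.coeff 0‖ ≤ ‖ρ a‖) (a : L1 T) (g : Γ) :
    ‖a.coeff g‖ ≤ ‖ρ a‖ := by
  refine (sq_le_sq₀ (norm_nonneg _) (norm_nonneg _)).1 ?_
  refine (a.norm_coeff_sq_le g).trans ((h _).trans_eq ?_)
  rw [map_mul, map_star, CStarRing.norm_self_mul_star, sq]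

/-- The powers of `a a^*` have supports of polynomial growth. -/
lemma norm_ι_le_of_finite_support (h : ∀ a, ‖a.coeff 0‖ ≤ ‖ρ a‖) {a : L1 T} {F : Finset Γ}
    (hF : ∀ g ∉ F, a.coeff g = 0) : ‖ι (L1 T) a‖ ≤ ‖ρ a‖ := by
  obtain ⟨F', hF'⟩ := L1.exists_support_mul_star hF
  set b := a * star a with hb
  have hsa : IsSelfAdjoint b := IsSelfAdjoint.mul_star_self a
  -- As `b` is self-adjoint, `‖ι b‖ ^ 2 ^ n` is exactly `‖ι (b ^ 2 ^ n)‖`. This is at most a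
  -- constant times the `ℓ¹`-norm of `b ^ 2 ^ n`, hence a constant times the size of its support
  -- times `‖ρ b‖ ^ 2 ^ n`.
  have key : ‖ι (L1 T) b‖ ≤ ‖ρ b‖ := by
    refine le_of_forall_pow_two_pow_le (K := Real.sqrt ‖(1 : L1 T)‖) (norm_nonneg _) F'.card
      fun n => ?_
    obtain ⟨G, hG, hG'⟩ := L1.exists_support_pow hF' (2 ^ n)
    have h1 : ‖ι (L1 T) b‖ ^ 2 ^ n = ‖ι (L1 T) (b ^ 2 ^ n)‖ := by
      rw [map_pow]
      exact (congrArg NNReal.toReal ((hsa.map (ι (L1 T))).nnnorm_pow_two_pow n)).symm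
    have h2 : ‖ρ (b ^ 2 ^ n)‖ ≤ ‖ρ b‖ ^ 2 ^ n := by
      rw [map_pow]
      exact norm_pow_le' _ (by positivity)
    have h3 : (G.card : ℝ) ≤ ((2 ^ n : ℕ) + 1 : ℝ) ^ F'.card := by exact_mod_cast hG
    rw [h1, mul_assoc]
    refine (norm_ι_le _).trans (mul_le_mul_of_nonneg_left ?_ (Real.sqrt_nonneg _))
    refine (L1.norm_le_card_mul hG' (norm_coeff_le_of_norm_coeff_zero_le h _)).trans ?_
    gcongr
  rw [hb, map_mul, map_mul, map_star, map_star, CStarRing.norm_self_mul_star,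
    CStarRing.norm_self_mul_star] at key
  exact (mul_self_le_mul_self_iff (norm_nonneg _) (norm_nonneg _)).2 key

lemma envNorm_le_of_norm_coeff_zero_le (hρ : Continuous ρ) (h : ∀ a, ‖a.coeff 0‖ ≤ ‖ρ a‖)
    (a : L1 T) : envNorm (L1 T) a ≤ ‖ρ a‖ := by
  rw [← norm_ι]
  have hι : Continuous (ι (L1 T)) := AddMonoidHomClass.continuous_of_bound _ _ norm_ι_le
  -- The finite partial sums of `a` converge to `a` in the `ℓ¹`-norm, and both norms are continuous
  -- for it.
  refine (isClosed_le (continuous_norm.comp hι) (continuous_norm.comp hρ)).mem_of_tendsto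
    a.hasSum_single (Filter.Eventually.of_forall fun F => ?_)
  refine norm_ι_le_of_finite_support h (F := F) fun g hg => ?_
  change L1.coeffCLM g (∑ k ∈ F, L1.single k (a.coeff k) (a.isCoeff_coeff k)) = 0
  rw [map_sum]
  refine Finset.sum_eq_zero fun k hk => ?_
  change (L1.single k (a.coeff k) (a.isCoeff_coeff k) : L1 T).coeff g = 0
  rw [L1.coeff_single, if_neg]
  rintro rfl
  exact hg hk

end Faithful

/-! ### Property (*) from the estimate of the zeroth coefficient. -/

section PropertyStar

variable {H : Type*} [NormedAddCommGroup H] [InnerProductSpace ℂ H] [CompleteSpace H]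
  {π : A →⋆ₐ[ℂ] (H →L[ℂ] H)} {U : Cone Γ → (H →L[ℂ] H)}

lemma IsCovariant.propertyStar (hc : IsCovariant T π U)
    (h : ∀ a : L1 T, ‖a.coeff 0‖ ≤ ‖hc.inducedRep a‖) : PropertyStar S π U := by
  intro F a hF ha
  let b : L1 T := ∑ x ∈ F, L1.single (-(x : Γ)) (a (-(x : Γ))) (ha _) + L1.single 0 (a 0) (ha 0) +
    ∑ x ∈ F, L1.single (x : Γ) (a x) (ha _)
  -- Because `0 ∉ F`, the terms indexed by `F` do not contribute to the coefficient of `b` at `0`.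
  have hne {x : Cone Γ} (hx : x ∈ F) : (0 : Γ) ≠ x := fun h0 => hF (by
    rwa [show x = 0 from Subtype.ext h0.symm] at hx)
  have h1 : b.coeff 0 = a 0 := by
    change L1.coeffCLM 0 b = a 0
    have h2 (g : Γ) : L1.coeffCLM 0 (L1.single g (a g) (ha g) : L1 T) =
      if 0 = g then a g else 0 := L1.coeff_single (T := T) g (a g) (ha g) 0
    rw [map_add, map_add, map_sum, map_sum, Finset.sum_eq_zero, Finset.sum_eq_zero, h2, if_pos rfl,
      zero_add, add_zero]
    · intro x hx
      rw [h2, if_neg (hne hx)]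
    · intro x hx
      rw [h2, if_neg fun h0 => hne hx (neg_eq_zero.1 h0.symm).symm]
  have h2 : hc.inducedRep b = ∑ x ∈ F, star (U x) * π (a (-(x : Γ))) + π (a 0) +
      ∑ x ∈ F, π (a x) * U x := by
    simp only [b, map_add, map_sum, hc.inducedRep_single]
    rw [inducedOp_of_nonneg le_rfl, cone_of_nonpos le_rfl, hc.U_zero, mul_one]
    congr 1
    · congr 1
      refine Finset.sum_congr rfl fun x _ => ?_
      rw [hc.inducedOp_of_nonpos (neg_nonpos.2 x.2), neg_neg, cone_coe]
    · refine Finset.sum_congr rfl fun x _ => ?_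
      rw [inducedOp_of_nonneg x.2, cone_coe]
  rw [← h2, ← h1]
  exact h b

end PropertyStar

/-! ### The zeroth coefficient in the regular representation. -/

section RegularRep

variable (T) in
/-- The representation of `l₁(Γ, α, A)` on the regular space. -/
def regularRep : L1 T →⋆ₐ[ℂ] (RegularSpace T →L[ℂ] RegularSpace T) :=
  (isCovariant_piRep_shiftOp (T := T)).inducedRep

/-- The image of `a δ_g` shifts degrees by `g`. Only the degree of the result matters later, for
orthogonality, so `w` is left unspecified. -/
lemma exists_inducedOp_vec (g : Γ) (a : A) (f : A →ₚ[ℂ] ℂ) (v : A) :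
    ∃ w, inducedOp (piRep T) (shiftOp T) g a (vec T f 0 v) = vec T f g w := by
  rcases le_total 0 g with hg | hg
  · refine ⟨piFun S a g (shiftFun S (cone g) g v), ?_⟩
    have h : vec T f 0 v = vec T f (g - (cone g : Cone Γ)) v := by
      rw [cone_of_nonneg hg, sub_self]
    rw [inducedOp_of_nonneg hg, mul_apply_eq_comp, h, shiftOp_vec, piRep_vec]
  · refine ⟨T.L (cone (min ((cone (-g) : Cone Γ) : Γ) 0)) (piFun S a 0 v), ?_⟩
    rw [isCovariant_piRep_shiftOp.inducedOp_of_nonpos hg, mul_apply_eq_comp, piRep_vec,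
      star_shiftOp_vec, cone_of_nonneg (neg_nonneg.2 hg), zero_sub, neg_neg]

/-- The functional depends on `a_0`, which is why the regular space sums over all positive
functionals. In degree `0` its summand is the GNS space of `f`, with `ξ` the class of `1` and `η`
the class of `a_0`. -/
lemma norm_coeff_zero_le_norm_regularRep (a : L1 T) : ‖a.coeff 0‖ ≤ ‖regularRep T a‖ := by
  obtain ⟨f, hf1, hf2⟩ := exists_positive_functional (a.coeff 0)
  set ξ := vec T f 0 1 with hξ
  set η := vec T f 0 (a.coeff 0) with hη
  have hform (u v : A) : form T f 0 u v = f (star u * v) := by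
    rw [form_of_nonneg le_rfl, cone_of_nonpos le_rfl, T.L_zero]
  have hsum : HasSum (fun g => inner ℂ η (inducedOp (piRep T) (shiftOp T) g (a.coeff g) ξ))
      (inner ℂ η (regularRep T a ξ)) :=
    ((isCovariant_piRep_shiftOp.hasSum_inducedRep a).mapL
      (ContinuousLinearMap.apply ℂ (RegularSpace T) ξ)).mapL (innerSL ℂ η)
  have h0 : inner ℂ η (regularRep T a ξ) = ((‖a.coeff 0‖ ^ 2 : ℝ) : ℂ) := by
    refine hsum.unique ?_
    -- The terms with `g ≠ 0` send `ξ` into degree `g`, which is orthogonal to `η`.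
    have h1 := hasSum_single (f := fun g => inner ℂ η
      (inducedOp (piRep T) (shiftOp T) g (a.coeff g) ξ)) 0 fun g hg => by
        obtain ⟨w, hw⟩ := exists_inducedOp_vec (T := T) g (a.coeff g) f 1
        rw [hξ, hw, hη, inner_vec_of_ne _ _ hg.symm]
    rwa [inducedOp_of_nonneg le_rfl, cone_of_nonpos le_rfl, shiftOp_zero, mul_one, hξ,
      piRep_vec_of_nonneg le_rfl, mul_one, hη, inner_vec, hform, hf2] at h1
  have hnorm (v : A) : ‖vec T f 0 v‖ ^ 2 = ‖f (star v * v)‖ := by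
    rw [← hform, ← inner_vec, inner_self_eq_norm_sq_to_K]
    simp
  have h1 : ‖ξ‖ ≤ 1 := by
    rw [← sq_le_one_iff₀ (norm_nonneg _), hnorm, star_one, mul_one]
    exact hf1
  have h2 : ‖η‖ = ‖a.coeff 0‖ := by
    rw [← sq_eq_sq₀ (norm_nonneg _) (norm_nonneg _), hnorm, hf2]
    simp
  have h3 : ‖a.coeff 0‖ ^ 2 ≤ ‖a.coeff 0‖ * ‖regularRep T a‖ := by
    calc ‖a.coeff 0‖ ^ 2 = ‖inner ℂ η (regularRep T a ξ)‖ := by rw [h0]; simp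
      _ ≤ ‖η‖ * (‖regularRep T a‖ * ‖ξ‖) := (norm_inner_le_norm _ _).trans
          (mul_le_mul_of_nonneg_left (ContinuousLinearMap.le_opNorm _ _) (norm_nonneg _))
      _ ≤ ‖a.coeff 0‖ * ‖regularRep T a‖ := by
          rw [h2]
          exact mul_le_mul_of_nonneg_left (mul_le_of_le_one_right (norm_nonneg _) h1) (norm_nonneg _)
  rcases (norm_nonneg (a.coeff 0)).eq_or_lt with h4 | h4
  · rw [← h4]; exact norm_nonneg _
  · rw [sq] at h3
    exact le_of_mul_le_mul_left h3 h4

end RegularRep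

end CrossedProduct

end

theorem mainTheorem11 {A : Type*} [CStarAlgebra A] [PartialOrder A] [StarOrderedRing A]
    {Γ : Type*} [AddCommGroup Γ] [LinearOrder Γ] [IsOrderedAddMonoid Γ]
    (S : CrossedProduct.DynamicalSystem A Γ) (T : CrossedProduct.CompleteTransferAction S) :
    ∃ (π : A →⋆ₐ[ℂ] (CrossedProduct.RegularSpace T →L[ℂ] CrossedProduct.RegularSpace T))
      (U : CrossedProduct.Cone Γ →
        (CrossedProduct.RegularSpace T →L[ℂ] CrossedProduct.RegularSpace T)),
      CrossedProduct.IsRegular T π U ∧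
      (∀ π' U', CrossedProduct.IsRegular T π' U' → π' = π ∧ U' = U) ∧
      CrossedProduct.IsCovariant T π U ∧
      CrossedProduct.PropertyStar S π U ∧
      ∃ Φ : CrossedProduct.CrossedProductAlgebra T →⋆ₐ[ℂ]
          (CrossedProduct.RegularSpace T →L[ℂ] CrossedProduct.RegularSpace T),
        CrossedProduct.IsInduced T π U Φ ∧
        (∀ Φ', CrossedProduct.IsInduced T π U Φ' → Φ' = Φ) ∧
        Function.Injective Φ := by
  open CrossedProduct Enveloping EnvelopingAlgebra in
  have hΦ : IsInduced T (piRep T) (shiftOp T) (lift (regularRep T)) := fun a => by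
    rw [lift_ι]
    exact isCovariant_piRep_shiftOp.hasSum_inducedRep a
  -- Two induced representations agree on the image of `l₁(Γ, α, A)`, where both are sums of the
  -- same family, and this image is dense.
  exact ⟨piRep T, shiftOp T, isRegular_piRep_shiftOp,
    fun _ _ h => isRegular_piRep_shiftOp.unique h, isCovariant_piRep_shiftOp,
    isCovariant_piRep_shiftOp.propertyStar norm_coeff_zero_le_norm_regularRep,
    lift (regularRep T), hΦ, fun Φ' h => starAlgHom_ext fun a => (h a).unique (hΦ a),
    lift_injective (envNorm_le_of_norm_coeff_zero_le
      isCovariant_piRep_shiftOp.continuous_inducedRep norm_coeff_zero_le_norm_regularRep)⟩
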